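/- Let $a\ge 4$ be an integer and let $\rho$ be a root, in some field of characteristic $0$ (for example $\mathbb{R}$ or $\mathbb{C}$), of the polynomial $x^3+(a-1)x^2-ax-1$. Then $\mathcal{P}(\mathbb{Z}[\rho])=6$. Here, for a commutative ring $\mathcal{O}$, the Pythagoras number $\mathcal{P}(\mathcal{O})$ is the least $m\in\mathbb{N}\cup\{\infty\}$ such that every element of $\mathcal{O}$ that is a sum of finitely many squares of elements of $\mathcal{O}$ is a sum of at most $m$ squares of elements of $\mathcal{O}$ (with no bound on the number of squares if $m=\infty$). -/

import Mathlib

/-- The set of elements of `R` that are sums of at most `m` squares of elements of `R`, for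
`m : ℕ∞`; for `m = ⊤` there is no bound on the (finite) number of squares. -/
def sumsOfAtMostSquares (R : Type*) [CommRing R] (m : ℕ∞) : Set R :=
  {x | ∃ n : ℕ, (n : ℕ∞) ≤ m ∧ ∃ α : Fin n → R, x = ∑ i, α i ^ 2}

/-- The Pythagoras number of a commutative ring `R`: the least `m : ℕ∞` such that every sum of
(finitely many) squares in `R` is a sum of at most `m` squares in `R`. -/
noncomputable def pythagorasNumber (R : Type*) [CommRing R] : ℕ∞ :=
  sInf {m : ℕ∞ | {x : R | IsSumSq x} = sumsOfAtMostSquares R m}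

/-! With ω = ρ² + aρ, the elements 1, ρ, ω form a ℤ-basis of ℤ[ρ]. A sum of squares in ℤ[ρ] is
determined by the Gram matrix of its three integer coefficient vectors, so both bounds concern
integral ternary forms.

Upper bound: every Gram matrix `Aᵀ * A` with three columns is also a Gram matrix of vectors in ℤ⁶
(`IntForm.exists_six_squares`). A positive definite ternary form is enlarged through overlattices
until it is primitive at the primes dividing its determinant, and 4 does not divide that
determinant. It then extends to a quaternary form of determinant D ≡ 1 mod 4, and Dirichlet's
theorem with quadratic reciprocity extends that to a unimodular form in six variables. By Hermite
reduction such a form is a sum of six squares.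

Lower bound: for 7 + (1 + ρ)² + ω², the three coordinates and Cauchy–Schwarz leave one possible Gram
matrix (`gram_eq_of_relations`). In it y and z are orthogonal unit vectors and x - y is orthogonal
to both with norm 7. Since 7 is not a sum of three squares, at least 2 + 4 coordinates are needed.
-/

namespace IntForm

open Matrix

set_option linter.unusedSectionVars false

/-! ### Hermite reduction and unimodular forms in at most six variables. -/

variable {ι κ : Type} [Fintype ι] [Fintype κ]

/-- The value at `v` of the quadratic form with Gram matrix `A`. -/
def qval (A : Matrix ι ι ℤ) (v : ι → ℤ) : ℤ := v ⬝ᵥ A *ᵥ v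

/-- Symmetric integer matrices that are positive definite on integer vectors. -/
structure IsPD (A : Matrix ι ι ℤ) : Prop where
  symm : Aᵀ = A
  pos : ∀ v, v ≠ 0 → 0 < qval A v

theorem qval_conj (A : Matrix ι ι ℤ) (W : Matrix ι κ ℤ) (y : κ → ℤ) :
    qval (Wᵀ * A * W) y = qval A (W *ᵥ y) := by
  simp only [qval, ← Matrix.mulVec_mulVec]
  rw [Matrix.dotProduct_mulVec, Matrix.vecMul_transpose]

theorem qval_submatrix (A : Matrix ι ι ℤ) (e : κ ≃ ι) (y : κ → ℤ) :
    qval (A.submatrix e e) y = qval A (y ∘ e.symm) := by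
  simp only [qval, dotProduct, Matrix.mulVec, Matrix.submatrix_apply, Function.comp]
  rw [← e.sum_comp]
  simp only [Equiv.symm_apply_apply]
  refine Finset.sum_congr rfl fun i _ => ?_
  rw [← e.sum_comp]
  simp

theorem IsPD.submatrix {A : Matrix ι ι ℤ} (hA : IsPD A) (e : κ ≃ ι) :
    IsPD (A.submatrix e e) where
  symm := by rw [Matrix.transpose_submatrix, hA.symm]
  pos v hv := by
    rw [qval_submatrix]
    refine hA.pos _ fun h => hv ?_
    funext i
    simpa using congrFun h (e i)

theorem IsPD.conj {A : Matrix ι ι ℤ} (hA : IsPD A) {W : Matrix ι κ ℤ}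
    (hW : ∀ y, W *ᵥ y = 0 → y = 0) : IsPD (Wᵀ * A * W) where
  symm := by
    simp only [Matrix.transpose_mul, Matrix.transpose_transpose, hA.symm, Matrix.mul_assoc]
  pos v hv := by
    rw [qval_conj]
    exact hA.pos _ fun h => hv (hW v h)

/-- The symmetric matrix `S` bordered by the row `r` and the corner `μ`. -/
def border (μ : ℤ) (r : κ → ℤ) (S : Matrix κ κ ℤ) : Matrix (Unit ⊕ κ) (Unit ⊕ κ) ℤ :=
  fromBlocks (of fun _ _ => μ) (replicateRow Unit r) (replicateCol Unit r) S

/-- The Schur complement of the corner of a bordered matrix, scaled to be integral. -/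
def schur (μ : ℤ) (r : κ → ℤ) (S : Matrix κ κ ℤ) : Matrix κ κ ℤ :=
  μ • S - vecMulVec r r

theorem qval_border (μ : ℤ) (r : κ → ℤ) (S : Matrix κ κ ℤ) (x : ℤ) (y : κ → ℤ) :
    qval (border μ r S) (Sum.elim (fun _ => x) y) =
      μ * x ^ 2 + 2 * x * (r ⬝ᵥ y) + qval S y := by
  simp only [qval, border, Matrix.fromBlocks_mulVec, sumElim_dotProduct_sumElim]
  have h1 : (fun _ : Unit => x) ⬝ᵥ ((of fun _ _ : Unit => μ) *ᵥ
      ((Sum.elim (fun _ : Unit => x) y) ∘ Sum.inl) +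
      replicateRow Unit r *ᵥ ((Sum.elim (fun _ : Unit => x) y) ∘ Sum.inr)) =
      x * (μ * x + r ⬝ᵥ y) := by
    simp [dotProduct, Matrix.mulVec]
  have h2 : y ⬝ᵥ (replicateCol Unit r *ᵥ ((Sum.elim (fun _ : Unit => x) y) ∘ Sum.inl) +
      S *ᵥ ((Sum.elim (fun _ : Unit => x) y) ∘ Sum.inr)) = x * (r ⬝ᵥ y) + y ⬝ᵥ S *ᵥ y := by
    rw [dotProduct_add]
    congr 1
    simp only [dotProduct, Matrix.mulVec, Finset.mul_sum]
    refine Finset.sum_congr rfl fun i _ => ?_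
    simp
    ring
  rw [h1, h2]
  ring

theorem qval_smul (A : Matrix ι ι ℤ) (c : ℤ) (v : ι → ℤ) :
    qval A (c • v) = c ^ 2 * qval A v := by
  simp only [qval, Matrix.mulVec_smul, dotProduct_smul, smul_dotProduct, smul_eq_mul]
  ring

theorem qval_schur (μ : ℤ) (r : κ → ℤ) (S : Matrix κ κ ℤ) (y : κ → ℤ) :
    qval (schur μ r S) y = μ * qval S y - (r ⬝ᵥ y) ^ 2 := by
  simp only [qval, schur, Matrix.sub_mulVec, dotProduct_sub, Matrix.smul_mulVec,
    dotProduct_smul, smul_eq_mul, Matrix.vecMulVec_mulVec]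
  simp [dotProduct_comm y r]
  ring

/-- Completing the square in the first variable, multiplied by μ so that everything stays integral.
-/
theorem mul_qval_border (μ : ℤ) (r : κ → ℤ) (S : Matrix κ κ ℤ) (x : ℤ) (y : κ → ℤ) :
    μ * qval (border μ r S) (Sum.elim (fun _ => x) y) =
      (μ * x + r ⬝ᵥ y) ^ 2 + qval (schur μ r S) y := by
  rw [qval_border, qval_schur]
  ring

theorem elim_ne_zero {x : ℤ} {y : κ → ℤ} (h : x ≠ 0 ∨ y ≠ 0) :
    (Sum.elim (fun _ : Unit => x) y) ≠ 0 := by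
  rintro h'
  rcases h with h | h
  · exact h (congrFun h' (Sum.inl ()))
  · exact h (funext fun i => congrFun h' (Sum.inr i))

theorem IsPD.corner_pos {μ : ℤ} {r : κ → ℤ} {S : Matrix κ κ ℤ} (h : IsPD (border μ r S)) :
    0 < μ := by
  have := h.pos _ (elim_ne_zero (x := 1) (y := (0 : κ → ℤ)) (Or.inl one_ne_zero))
  rw [qval_border] at this
  simpa [qval] using this

theorem IsPD.schur {μ : ℤ} {r : κ → ℤ} {S : Matrix κ κ ℤ} (h : IsPD (border μ r S)) :
    IsPD (schur μ r S) where
  symm := by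
    have hS : Sᵀ = S := by
      have := h.symm
      rw [border, Matrix.fromBlocks_transpose] at this
      exact (Matrix.fromBlocks_inj.1 this).2.2.2
    simp [IntForm.schur, hS, Matrix.transpose_vecMulVec]
  pos y hy := by
    have hμ := h.corner_pos
    have h1 := mul_qval_border μ r S (-(r ⬝ᵥ y)) (μ • y)
    rw [qval_smul, dotProduct_smul, smul_eq_mul] at h1
    have h2 := h.pos (Sum.elim (fun _ => -(r ⬝ᵥ y)) (μ • y)) (elim_ne_zero (Or.inr 
      (smul_ne_zero hμ.ne' hy)))
    have h3 : 0 < μ ^ 2 * qval (IntForm.schur μ r S) y := by nlinarith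
    exact pos_of_mul_pos_right h3 (by positivity)

variable [DecidableEq ι] [DecidableEq κ]

theorem det_border (μ : ℤ) (r : κ → ℤ) (S : Matrix κ κ ℤ) :
    μ * (schur μ r S).det = μ ^ Fintype.card κ * (border μ r S).det := by
  have key : (fromBlocks (1 : Matrix Unit Unit ℤ) 0 (-(replicateCol Unit r))
      (μ • (1 : Matrix κ κ ℤ))) * border μ r S =
      fromBlocks (of fun _ _ => μ) (replicateRow Unit r) 0 (schur μ r S) := by
    rw [border, Matrix.fromBlocks_multiply]
    congr 1
    · simp
    · simp
    · rw [Matrix.smul_mul, Matrix.one_mul]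
      ext i j
      simp [Matrix.mul_apply]
      ring
    · rw [Matrix.smul_mul, Matrix.one_mul]
      ext i j
      simp only [Matrix.add_apply, Matrix.neg_mul, Matrix.neg_apply, schur, Matrix.sub_apply,
        Matrix.vecMulVec_apply, Matrix.mul_apply, Matrix.replicateCol_apply,
        Matrix.replicateRow_apply, Finset.univ_unique, Finset.sum_const, Finset.card_singleton,
        one_smul]
      ring
  have := congrArg Matrix.det key
  rw [Matrix.det_mul, Matrix.det_fromBlocks_zero₁₂, Matrix.det_fromBlocks_zero₂₁] at this
  rw [Matrix.det_smul] at this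
  simp only [Matrix.det_one, one_mul, mul_one, Matrix.det_unique, Matrix.of_apply,
    Matrix.one_apply_eq] at this
  exact this.symm

theorem det_conj (A U : Matrix ι ι ℤ) (hU : IsUnit U.det) : (Uᵀ * A * U).det = A.det := by
  rw [Matrix.det_mul, Matrix.det_mul, Matrix.det_transpose]
  rcases Int.isUnit_iff.1 hU with h | h <;> rw [h] <;> ring

theorem mulVec_injective_of_isUnit {U : Matrix ι ι ℤ} (hU : IsUnit U.det) (y : ι → ℤ)
    (h : U *ᵥ y = 0) : y = 0 := by
  have : U⁻¹ *ᵥ (U *ᵥ y) = 0 := by rw [h, Matrix.mulVec_zero]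
  rwa [Matrix.mulVec_mulVec, Matrix.nonsing_inv_mul _ hU, Matrix.one_mulVec] at this

/-- Vectors that occur as a column of an invertible integer matrix. -/
def IsExt (v : ι → ℤ) : Prop :=
  ∃ U : Matrix ι ι ℤ, IsUnit U.det ∧ ∃ i, v = fun j => U j i

theorem IsExt.mulVec {v : ι → ℤ} (hv : IsExt v) {V : Matrix ι ι ℤ} (hV : IsUnit V.det) :
    IsExt (V *ᵥ v) := by
  obtain ⟨U, hU, i, rfl⟩ := hv
  exact ⟨V * U, by rw [Matrix.det_mul]; exact hV.mul hU, i, by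
    funext j; simp [Matrix.mul_apply, Matrix.mulVec, dotProduct]⟩

theorem IsExt.comp {v : κ → ℤ} (hv : IsExt v) (e : κ ≃ ι) : IsExt (v ∘ e.symm) := by
  obtain ⟨U, hU, i, rfl⟩ := hv
  exact ⟨U.submatrix e.symm e.symm, by rwa [Matrix.det_submatrix_equiv_self], e i, by
    funext j; simp⟩

/-- Lifts a vector of the reduced form to the original one; the new coordinate is free, so it can be
chosen to make the square term small. -/
theorem IsExt.sumElim {v : κ → ℤ} (hv : IsExt v) (x : ℤ) :
    IsExt (Sum.elim (fun _ : Unit => x) v) := by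
  obtain ⟨U, hU, i, rfl⟩ := hv
  refine ⟨fromBlocks 1 (replicateRow Unit (Pi.single i x)) 0 U, ?_, Sum.inr i, ?_⟩
  · rw [Matrix.det_fromBlocks_zero₂₁]; simpa using hU
  · funext j
    rcases j with j | j <;> simp

theorem IsExt.ne_zero {v : ι → ℤ} (hv : IsExt v) : v ≠ 0 := by
  obtain ⟨U, hU, i, rfl⟩ := hv
  intro h
  have : U.det = 0 := Matrix.det_eq_zero_of_column_eq_zero i fun j => congrFun h j
  rw [this] at hU
  exact not_isUnit_zero hU

theorem isExt_single (i : ι) : IsExt (Pi.single i 1 : ι → ℤ) :=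
  ⟨1, by simp, i, by funext j; simp [Matrix.one_apply, Pi.single_apply]⟩

theorem IsExt.exists_border {v : ι → ℤ} (hv : IsExt v) {n : ℕ} (hn : Fintype.card ι = n + 1)
    {A : Matrix ι ι ℤ} (hA : Aᵀ = A) :
    ∃ (U : Matrix ι ι ℤ) (e : Unit ⊕ Fin n ≃ ι) (r : Fin n → ℤ) (S : Matrix (Fin n) (Fin n) ℤ),
      IsUnit U.det ∧ (Uᵀ * A * U).submatrix e e = border (qval A v) r S := by
  obtain ⟨U, hU, i, rfl⟩ := hv
  obtain ⟨e₀⟩ : Nonempty (Unit ⊕ Fin n ≃ ι) :=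
    ⟨Fintype.equivOfCardEq (by simp [hn, add_comm])⟩
  set e : Unit ⊕ Fin n ≃ ι := e₀.trans (Equiv.swap (e₀ (Sum.inl ())) i)
  have he : e (Sum.inl ()) = i := by simp [e]
  set B := (Uᵀ * A * U).submatrix e e with hB
  have hBs : Bᵀ = B := by
    rw [hB, Matrix.transpose_submatrix]
    simp only [Matrix.transpose_mul, Matrix.transpose_transpose, hA, Matrix.mul_assoc]
  refine ⟨U, e, fun j => B (Sum.inl ()) (Sum.inr j), B.toBlocks₂₂, hU, ?_⟩
  conv_lhs => rw [← hB, ← Matrix.fromBlocks_toBlocks B]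
  rw [border]
  congr 1
  · ext a b
    simp only [Matrix.toBlocks₁₁, Matrix.of_apply, hB, Matrix.submatrix_apply, he]
    simp only [qval, Matrix.mul_apply, dotProduct, Matrix.mulVec, Matrix.transpose_apply,
      Finset.sum_mul, Finset.mul_sum]
    rw [Finset.sum_comm]
    exact Finset.sum_congr rfl fun x _ => Finset.sum_congr rfl fun y _ => by ring
  · ext a b
    simp only [Matrix.toBlocks₂₁, Matrix.of_apply, Matrix.replicateCol_apply]
    exact congrFun (congrFun hBs (Sum.inl ())) (Sum.inr a) |>.symm ▸ rfl

theorem exists_int_abs_le (μ : ℤ) (hμ : 0 < μ) (t : ℤ) : ∃ x : ℤ, 2 * |μ * x + t| ≤ μ := by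
  -- This is -⌊t/μ + 1/2⌋: t/μ is rounded to the nearest integer.
  refine ⟨-((2 * t + μ) / (2 * μ)), ?_⟩
  have h1 := Int.emod_add_mul_ediv (2 * t + μ) (2 * μ)
  have h2 := Int.emod_nonneg (2 * t + μ) (b := 2 * μ) (by omega)
  have h3 := Int.emod_lt_of_pos (2 * t + μ) (b := 2 * μ) (by omega)
  have : |μ * -((2 * t + μ) / (2 * μ)) + t| * 2 ≤ μ := by
    have h4 : |(μ * -((2 * t + μ) / (2 * μ)) + t) * 2| ≤ μ := by
      rw [abs_le]
      constructor <;> nlinarith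
    rwa [abs_mul] at h4
  linarith

/-- Reduction of a positive definite form along an extendable vector. -/
theorem IsPD.exists_reduction {A : Matrix ι ι ℤ} (hA : IsPD A) {v : ι → ℤ} (hv : IsExt v)
    {n : ℕ} (hn : Fintype.card ι = n + 1) :
    ∃ T : Matrix (Fin n) (Fin n) ℤ, IsPD T ∧ qval A v * T.det = qval A v ^ n * A.det ∧
      ∀ u, IsExt u → ∃ x, IsExt x ∧ ∃ ρ : ℤ, 2 * |ρ| ≤ qval A v ∧
        qval A v * qval A x = ρ ^ 2 + qval T u := by
  obtain ⟨U, e, r, S, hU, hB⟩ := hv.exists_border hn hA.symm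
  have hPD : IsPD (border (qval A v) r S) := by
    rw [← hB]
    exact (hA.conj (mulVec_injective_of_isUnit hU)).submatrix e
  refine ⟨_, hPD.schur, ?_, fun u hu => ?_⟩
  · have := det_border (qval A v) r S
    rwa [Fintype.card_fin, ← hB, Matrix.det_submatrix_equiv_self, det_conj _ _ hU] at this
  · obtain ⟨x, hx⟩ := exists_int_abs_le _ hPD.corner_pos (r ⬝ᵥ u)
    refine ⟨U *ᵥ (Sum.elim (fun _ => x) u ∘ e.symm), ((hu.sumElim x).comp e).mulVec hU, _, hx, ?_⟩
    rw [← mul_qval_border, ← qval_conj, ← qval_submatrix, hB]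

theorem IsPD.det_pos {A : Matrix ι ι ℤ} (hA : IsPD A) : 0 < A.det := by
  obtain ⟨n, hn⟩ : ∃ n, Fintype.card ι = n := ⟨_, rfl⟩
  induction n generalizing ι with
  | zero =>
    have := Fintype.card_eq_zero_iff.1 hn
    simp
  | succ n ih =>
    obtain ⟨i⟩ : Nonempty ι := Fintype.card_pos_iff.1 (by omega)
    obtain ⟨T, hT, hd, -⟩ := hA.exists_reduction (isExt_single i) hn
    have hμ := hA.pos _ (isExt_single i).ne_zero
    have hTd := ih hT (Fintype.card_fin n)
    have : 0 < qval A (Pi.single i 1) ^ n * A.det := by rw [← hd]; positivity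
    exact pos_of_mul_pos_right this (by positivity)

/-- Extendable vectors of least value. -/
theorem IsPD.exists_min {A : Matrix ι ι ℤ} (hA : IsPD A) [Nonempty ι] :
    ∃ v, IsExt v ∧ ∀ x, IsExt x → qval A v ≤ qval A x := by
  obtain ⟨i⟩ := ‹Nonempty ι›
  obtain ⟨v, hv, h⟩ := WellFounded.has_min
    (InvImage.wf (fun v : ι → ℤ => (qval A v).toNat) Nat.lt_wfRel.wf)
    {v | IsExt v} ⟨_, isExt_single i⟩
  refine ⟨v, hv, fun x hx => ?_⟩
  have h1 := h x hx
  have h2 := hA.pos _ hx.ne_zero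
  simp only [InvImage] at h1
  change ¬ (_ < _) at h1
  omega

/-- Hermite's bound μ^m ≤ (4/3)^(m(m-1)/2) det A for m variables. For minimal μ, the relation μ A(x)
= ρ² + T(u) with |ρ| ≤ μ/2 gives 4 T(u) ≥ 3μ²; the bound for T then yields the one for A. -/
theorem IsPD.hermite {A : Matrix ι ι ℤ} (hA : IsPD A) {n : ℕ} (hn : Fintype.card ι = n + 1) :
    ∃ v, IsExt v ∧ (∀ x, IsExt x → qval A v ≤ qval A x) ∧
      qval A v ^ (n + 1) * 3 ^ ((n + 1).choose 2) ≤ 4 ^ ((n + 1).choose 2) * A.det := by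
  induction n generalizing ι with
  | zero =>
    have : Nonempty ι := Fintype.card_pos_iff.1 (by omega)
    obtain ⟨v, hv, hmin⟩ := hA.exists_min
    obtain ⟨T, hT, hd, -⟩ := hA.exists_reduction hv hn
    refine ⟨v, hv, hmin, ?_⟩
    simp at hd
    simp [hd]
  | succ n ih =>
    have : Nonempty ι := Fintype.card_pos_iff.1 (by omega)
    obtain ⟨v, hv, hmin⟩ := hA.exists_min
    refine ⟨v, hv, hmin, ?_⟩
    obtain ⟨T, hT, hd, hred⟩ := hA.exists_reduction hv hn
    obtain ⟨u, hu, -, hb⟩ := ih hT (Fintype.card_fin _)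
    obtain ⟨x, hx, ρ, hρ, he⟩ := hred u hu
    have hμ : 0 < qval A v := hA.pos _ hv.ne_zero
    have hx' := hmin x hx
    set μ := qval A v
    set t := qval T u
    have h34 : 3 * μ ^ 2 ≤ 4 * t := by
      have h1 : (2 * |ρ|) ^ 2 ≤ μ ^ 2 := by gcongr
      rw [mul_pow, sq_abs] at h1
      nlinarith
    have hpow : (3 * μ ^ 2) ^ (n + 1) ≤ (4 * t) ^ (n + 1) := by gcongr
    set c := (n + 1).choose 2
    have hc : (n + 1 + 1).choose 2 = n + 1 + c := by
      rw [Nat.choose_succ_succ' (n + 1) 1]; simp [c]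
    rw [hc]
    have h5 : μ ^ (n + 1) * (μ ^ (n + 1 + 1) * 3 ^ (n + 1 + c)) ≤
        μ ^ (n + 1) * (4 ^ (n + 1 + c) * A.det) := by
      calc μ ^ (n + 1) * (μ ^ (n + 1 + 1) * 3 ^ (n + 1 + c))
          = (3 * μ ^ 2) ^ (n + 1) * (μ * 3 ^ c) := by ring
        _ ≤ (4 * t) ^ (n + 1) * (μ * 3 ^ c) := by gcongr
        _ = 4 ^ (n + 1) * μ * (t ^ (n + 1) * 3 ^ c) := by ring
        _ ≤ 4 ^ (n + 1) * μ * (4 ^ c * T.det) := by gcongr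
        _ = 4 ^ (n + 1) * 4 ^ c * (μ * T.det) := by ring
        _ = μ ^ (n + 1) * (4 ^ (n + 1 + c) * A.det) := by rw [hd]; ring
    exact le_of_mul_le_mul_left h5 (by positivity)

/-- A unimodular positive definite form in at most six variables takes the value `1`. -/
theorem IsPD.exists_qval_eq_one {A : Matrix ι ι ℤ} (hA : IsPD A) (hd : A.det = 1) {n : ℕ}
    (hn : Fintype.card ι = n + 1) (hn5 : n ≤ 5) : ∃ v, IsExt v ∧ qval A v = 1 := by
  obtain ⟨v, hv, hmin, hb⟩ := hA.hermite hn
  refine ⟨v, hv, ?_⟩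
  have hμ : 0 < qval A v := hA.pos _ hv.ne_zero
  by_contra hne
  have h2 : 2 ≤ qval A v := by omega
  have hb2 : 2 ^ (n + 1) * 3 ^ ((n + 1).choose 2) ≤ (4 : ℤ) ^ ((n + 1).choose 2) := by
    calc (2 : ℤ) ^ (n + 1) * 3 ^ ((n + 1).choose 2)
        ≤ qval A v ^ (n + 1) * 3 ^ ((n + 1).choose 2) := by gcongr
      _ ≤ _ := by rw [hd, mul_one] at hb; exact hb
  -- Up to five variables Hermite's bound already excludes a minimum of 2. In six variables (4/3)^15
  -- > 2^6, so the two successive reductions have to be followed.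
  have hn6 : n = 5 := by
    interval_cases n <;> first | rfl | (exfalso; revert hb2; norm_num [Nat.choose])
  subst hn6
  have h3 : qval A v = 2 := by
    by_contra h
    have h3 : 3 ≤ qval A v := by omega
    have : (3 : ℤ) ^ 6 ≤ qval A v ^ 6 := by gcongr
    norm_num [Nat.choose, hd] at hb
    omega
  -- T has determinant 16 and values at least 2·2 - 1 = 3, and Hermite makes its minimum 3. Its
  -- reduction R has determinant 432 and a value at most 7, so some T(x) ≤ (1 + 7)/3 < 3.
  obtain ⟨T, hT, hTd, hTred⟩ := hA.exists_reduction hv hn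
  rw [h3, hd] at hTd
  have hTd' : T.det = 16 := by omega
  have lower : ∀ u, IsExt u → 3 ≤ qval T u := by
    intro u hu
    obtain ⟨x, hx, ρ, hρ, he⟩ := hTred u hu
    have := hmin x hx
    rw [h3] at hρ he this
    have h1 := abs_le.1 (show |ρ| ≤ 1 by omega)
    nlinarith
  obtain ⟨u, hu, humin, hub⟩ := hT.hermite (n := 4) (by simp)
  have hu3 : qval T u = 3 := by
    have := lower u hu
    by_contra h
    have h4 : 4 ≤ qval T u := by omega
    have : (4 : ℤ) ^ 5 ≤ qval T u ^ 5 := by gcongr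
    norm_num [Nat.choose, hTd'] at hub
    omega
  obtain ⟨R, hR, hRd, hRred⟩ := hT.exists_reduction (n := 4) hu (by simp)
  rw [hu3, hTd'] at hRd
  have hRd' : R.det = 432 := by omega
  obtain ⟨w, hw, -, hwb⟩ := hR.hermite (n := 3) (by simp)
  have hw7 : qval R w ≤ 7 := by
    by_contra h
    have h8 : 8 ≤ qval R w := by omega
    have : (8 : ℤ) ^ 4 ≤ qval R w ^ 4 := by gcongr
    norm_num [Nat.choose, hRd'] at hwb
    omega
  obtain ⟨x, hx, ρ, hρ, he⟩ := hRred w hw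
  have := lower x hx
  rw [hu3] at hρ he
  have h1 := abs_le.1 (show |ρ| ≤ 1 by omega)
  nlinarith

/-- Unimodular positive definite forms in at most six variables are sums of squares. -/
theorem IsPD.exists_eq_transpose_mul_self {n : ℕ} (hn : n ≤ 6) {A : Matrix ι ι ℤ}
    (hι : Fintype.card ι = n) (hA : IsPD A) (hd : A.det = 1) :
    ∃ B : Matrix (Fin n) ι ℤ, A = Bᵀ * B := by
  induction n generalizing ι with
  | zero =>
    have := Fintype.card_eq_zero_iff.1 hι
    exact ⟨0, Subsingleton.elim _ _⟩
  | succ n ih =>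
    obtain ⟨v, hv, hv1⟩ := hA.exists_qval_eq_one hd hι (by omega)
    obtain ⟨U, e, r, S, hU, hB⟩ := hv.exists_border hι hA.symm
    rw [hv1] at hB
    have hPD : IsPD (border 1 r S) := by
      rw [← hB]
      exact (hA.conj (mulVec_injective_of_isUnit hU)).submatrix e
    -- With corner 1 the Schur complement is not rescaled, so it is again unimodular and the
    -- induction continues.
    have hdet : (IntForm.schur 1 r S).det = 1 := by
      have := det_border 1 r S
      rwa [← hB, Matrix.det_submatrix_equiv_self, det_conj _ _ hU, hd, one_pow, one_mul,
        one_mul] at this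
    obtain ⟨C, hC⟩ := ih (by omega) (Fintype.card_fin n) hPD.schur hdet
    obtain ⟨f⟩ : Nonempty (Fin (n + 1) ≃ Unit ⊕ Fin n) :=
      ⟨Fintype.equivOfCardEq (by simp [add_comm])⟩
    set M : Matrix (Unit ⊕ Fin n) (Unit ⊕ Fin n) ℤ := fromBlocks 1 (replicateRow Unit r) 0 C
    have hM : border 1 r S = Mᵀ * M := by
      rw [border, Matrix.fromBlocks_transpose, Matrix.fromBlocks_multiply]
      congr 1
      · ext; simp
      · simp
      · ext; simp
      · have : S = IntForm.schur 1 r S + vecMulVec r r := by simp [IntForm.schur]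
        conv_lhs => rw [this, hC]
        rw [add_comm]
        congr 1
        ext i j
        simp [Matrix.mul_apply, Matrix.vecMulVec_apply]
    set N : Matrix ι ι ℤ := M.submatrix e.symm e.symm
    have hN : Uᵀ * A * U = Nᵀ * N := by
      rw [Matrix.transpose_submatrix, Matrix.submatrix_mul_equiv, ← hM, ← hB]
      ext i j
      simp
    have hA' : A = (N * U⁻¹)ᵀ * (N * U⁻¹) := by
      have h1 : U * U⁻¹ = 1 := Matrix.mul_nonsing_inv _ hU
      have h2 : (U⁻¹)ᵀ * Uᵀ = 1 := by rw [← Matrix.transpose_mul, h1, Matrix.transpose_one]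
      calc A = ((U⁻¹)ᵀ * Uᵀ) * A * (U * U⁻¹) := by rw [h1, h2]; simp
        _ = (U⁻¹)ᵀ * (Uᵀ * A * U) * U⁻¹ := by simp only [Matrix.mul_assoc]
        _ = _ := by rw [hN, Matrix.transpose_mul]; simp only [Matrix.mul_assoc]
    refine ⟨(N * U⁻¹).submatrix (f.trans e) id, ?_⟩
    rw [Matrix.transpose_submatrix, Matrix.submatrix_mul_equiv]
    simpa using hA'

end IntForm

/-! ### From quaternary forms to unimodular forms in six variables. -/

namespace IntForm

open Matrix
open scoped NumberTheorySymbols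

set_option linter.unusedSectionVars false

variable {ι κ : Type} [Fintype ι] [Fintype κ] [DecidableEq ι] [DecidableEq κ]

theorem det_border_eq (c : ℤ) (b : κ → ℤ) {f : Matrix κ κ ℤ} (hf : f.det ≠ 0) :
    (border c b f).det = c * f.det - qval f.adjugate b := by
  have key : fromBlocks (of fun _ _ : Unit => f.det) (replicateRow Unit (-(b ᵥ* f.adjugate)))
      0 (1 : Matrix κ κ ℤ) * border c b f =
      fromBlocks (of fun _ _ : Unit => c * f.det - qval f.adjugate b) 0
        (replicateCol Unit b) f := by
    rw [border, Matrix.fromBlocks_multiply]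
    congr 1
    · ext i j
      simp only [Matrix.add_apply, Matrix.mul_apply, Matrix.of_apply, Matrix.replicateRow_apply,
        Matrix.replicateCol_apply, Pi.neg_apply, neg_mul, Finset.sum_neg_distrib,
        Finset.univ_unique, Finset.sum_const, Finset.card_singleton, one_smul]
      rw [qval, Matrix.dotProduct_mulVec]
      simp only [dotProduct]
      ring
    · have h1 : replicateRow Unit (-(b ᵥ* f.adjugate)) * f = replicateRow Unit (-(f.det • b)) := by
        ext i j
        change (-(b ᵥ* f.adjugate) ᵥ* f) j = _
        rw [Matrix.neg_vecMul, Matrix.vecMul_vecMul, Matrix.adjugate_mul, Matrix.vecMul_smul,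
          Matrix.vecMul_one]
        simp
      rw [h1]
      ext i j
      simp [Matrix.mul_apply]
    · simp
    · simp
  have := congrArg Matrix.det key
  rw [Matrix.det_mul, Matrix.det_fromBlocks_zero₂₁, Matrix.det_fromBlocks_zero₁₂] at this
  simp only [Matrix.det_one, mul_one, Matrix.det_unique, Matrix.of_apply] at this
  rw [mul_comm] at this
  exact mul_right_cancel₀ hf this

/-- One step of Sylvester's criterion. The square is completed with `f.adjugate *ᵥ b` in place of
f⁻¹b, at the cost of the factor `f.det ^ 2`. -/
theorem IsPD.border {c : ℤ} {b : κ → ℤ} {f : Matrix κ κ ℤ} (hf : IsPD f)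
    (h : 0 < (border c b f).det) : IsPD (border c b f) where
  symm := by
    rw [IntForm.border, Matrix.fromBlocks_transpose, hf.symm]
    congr 1
  pos v hv := by
    have hd := hf.det_pos
    obtain ⟨x, y, rfl⟩ : ∃ x y, v = Sum.elim (fun _ : Unit => x) y :=
      ⟨v (Sum.inl ()), fun i => v (Sum.inr i), by funext i; rcases i with i | i <;> rfl⟩
    have key : f.det ^ 2 * qval (IntForm.border c b f) (Sum.elim (fun _ => x) y) =
        qval f (f.det • y + x • (f.adjugate *ᵥ b)) +
          x ^ 2 * f.det * (IntForm.border c b f).det := by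
      have hw : f *ᵥ (f.adjugate *ᵥ b) = f.det • b := by
        rw [Matrix.mulVec_mulVec, Matrix.mul_adjugate, Matrix.smul_mulVec, Matrix.one_mulVec]
      have hc : (f.adjugate *ᵥ b) ⬝ᵥ (f *ᵥ y) = f.det * (b ⬝ᵥ y) := by
        rw [Matrix.dotProduct_mulVec, ← Matrix.mulVec_transpose, hf.symm, hw, smul_dotProduct,
          smul_eq_mul]
      rw [qval_border, det_border_eq _ _ hd.ne']
      simp only [qval, Matrix.mulVec_add, Matrix.mulVec_smul, dotProduct_add, add_dotProduct,
        smul_dotProduct, dotProduct_smul, smul_eq_mul, hw, hc]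
      rw [dotProduct_comm y b, dotProduct_comm (f.adjugate *ᵥ b) b]
      ring
    refine pos_of_mul_pos_right (a := f.det ^ 2) ?_ (by positivity)
    rw [key]
    by_cases hx : x = 0
    · subst hx
      have hy : y ≠ 0 := by
        rintro rfl
        exact hv (by funext i; rcases i with i | i <;> rfl)
      have := hf.pos _ (smul_ne_zero hd.ne' hy)
      simpa using this
    · have h1 : 0 ≤ qval f (f.det • y + x • (f.adjugate *ᵥ b)) := by
        by_cases h0 : f.det • y + x • (f.adjugate *ᵥ b) = 0
        · rw [h0]; simp [qval]
        · exact (hf.pos _ h0).le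
      positivity

theorem adjugate_border_inl (c : ℤ) (b : κ → ℤ) (f : Matrix κ κ ℤ) :
    (border c b f).adjugate (Sum.inl ()) (Sum.inl ()) = f.det := by
  rw [Matrix.adjugate_apply]
  have : (border c b f).updateRow (Sum.inl ()) (Pi.single (Sum.inl ()) 1) =
      fromBlocks (1 : Matrix Unit Unit ℤ) 0 (replicateCol Unit b) f := by
    ext i j
    rcases i with i | i <;> rcases j with j | j <;> simp [Matrix.updateRow_apply, border]
  rw [this, Matrix.det_fromBlocks_zero₁₂]
  simp

theorem qval_single (A : Matrix ι ι ℤ) (i : ι) (s : ℤ) :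
    qval A (Pi.single i s) = s ^ 2 * A i i := by
  simp [qval, Matrix.mulVec_single]
  ring

/-- Choosing m ≡ -N⁻¹ mod D makes E integral, and DE ≡ 1 mod m, so -E is a square mod m once -D is.
As D ≡ 1 mod 4, (-D/m) = χ₄(m)(m/D), where (m/D) is already fixed; the class of m mod 4 is chosen to
make the product 1, and Dirichlet supplies m. -/
theorem exists_prime_dvd_sq_add {D : ℕ} (hD : D % 4 = 1) {N : ℤ} (hN : IsCoprime N (D : ℤ)) :
    ∃ (m : ℕ) (s E : ℤ), m.Prime ∧ (D : ℤ) * E = 1 + N * m ∧ (m : ℤ) ∣ s ^ 2 + E := by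
  obtain ⟨u, v, huv⟩ := hN
  obtain ⟨ε, hε, hεJ⟩ : ∃ ε : ℤ, (ε = 1 ∨ ε = 3) ∧ (ε = 1 ↔ J(-u | D) = 1) := by
    by_cases h : J(-u | D) = 1
    · exact ⟨1, by simp, by simp [h]⟩
    · exact ⟨3, by simp, by simp [h]⟩
  -- Congruent to -u mod D, and to ε mod 4 because D ≡ 1 mod 4.
  set m₀ : ℤ := -u + D * (ε + u) with hm₀
  have hcop : IsCoprime m₀ ((4 * D : ℕ) : ℤ) := by
    push_cast
    refine IsCoprime.mul_right ?_ ?_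
    · obtain ⟨k, hk⟩ : ∃ k : ℤ, m₀ = ε + 4 * k := by
        refine ⟨(D / 4 : ℕ) * (ε + u), ?_⟩
        have : (D : ℤ) = 4 * (D / 4 : ℕ) + 1 := by omega
        rw [hm₀]
        conv_lhs => rw [this]
        ring
      rw [hk]
      refine (IsCoprime.add_mul_left_left ?_ k)
      rcases hε with rfl | rfl
      · exact isCoprime_one_left
      · exact ⟨-1, 1, by norm_num⟩
    · rw [hm₀]
      refine IsCoprime.add_mul_left_left ?_ _
      exact ⟨-N, v, by linarith⟩
  have : NeZero (4 * D) := ⟨by omega⟩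
  have hunit : IsUnit ((m₀ : ℤ) : ZMod (4 * D)) := by
    obtain ⟨x, y, hxy⟩ := hcop
    refine .of_mul_eq_one (x : ZMod (4 * D)) ?_
    have := congrArg (Int.cast : ℤ → ZMod (4 * D)) hxy
    rw [Int.cast_add, Int.cast_mul, Int.cast_mul, Int.cast_natCast, ZMod.natCast_self] at this
    simpa [mul_comm] using this
  obtain ⟨p, -, hp, hpm⟩ := Nat.forall_exists_prime_gt_and_eq_mod hunit 0
  have hdiv : ((4 * D : ℕ) : ℤ) ∣ (p : ℤ) - m₀ := by
    rw [← ZMod.intCast_zmod_eq_zero_iff_dvd]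
    push_cast
    rw [hpm, sub_self]
  obtain ⟨k, hk⟩ := hdiv
  push_cast at hk
  have hpu : (p : ℤ) = -u + D * (ε + u + 4 * k) := by rw [hm₀] at hk; linarith
  have hE : (D : ℤ) * (v + N * (ε + u + 4 * k)) = 1 + N * p := by
    rw [hpu]; linarith
  set E := v + N * (ε + u + 4 * k)
  have hp4 : (p : ℤ) % 4 = ε := by
    have : (p : ℤ) = ε + 4 * ((D / 4 : ℕ) * (ε + u + 4 * k) + k) := by
      have : (D : ℤ) = 4 * (D / 4 : ℕ) + 1 := by omega
      rw [hpu]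
      conv_lhs => rw [this]
      ring
    omega
  have hodd : Odd p := by
    rw [Nat.odd_iff]
    omega
  have hJp : J(p | D) = J(-u | D) := by
    refine jacobiSym.mod_left' ?_
    rw [hpu, Int.add_mul_emod_self_left]
  have hpD : IsCoprime (p : ℤ) D := ⟨-N, E, by linarith⟩
  have hJ1 : J(-D | p) = 1 := by
    rw [jacobiSym.neg _ hodd, jacobiSym.quadratic_reciprocity_one_mod_four hD hodd]
    rcases hε with rfl | rfl
    · rw [ZMod.χ₄_nat_one_mod_four (by omega), hJp, hεJ.1 rfl, one_mul]
    · have h3 : J(-u | D) ≠ 1 := fun h => by simpa using hεJ.2 h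
      rw [← hJp] at h3
      rw [ZMod.χ₄_nat_three_mod_four (by omega)]
      rcases jacobiSym.eq_one_or_neg_one (Int.isCoprime_iff_gcd_eq_one.1 hpD) with h | h
      · exact absurd h h3
      · rw [h]; norm_num
  have : Fact p.Prime := ⟨hp⟩
  obtain ⟨t, ht⟩ := ZMod.isSquare_of_jacobiSym_eq_one hJ1
  obtain ⟨s, rfl⟩ := ZMod.intCast_surjective t
  refine ⟨p, s * E, E, hp, hE, ?_⟩
  rw [← ZMod.intCast_zmod_eq_zero_iff_dvd]
  have hE' := congrArg (Int.cast : ℤ → ZMod p) hE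
  push_cast at ht hE' ⊢
  rw [ZMod.natCast_self, mul_zero, add_zero] at hE'
  linear_combination (-(E : ZMod p) ^ 2) * ht - (E : ZMod p) * hE'

/-- A positive definite form of suitable determinant embeds into a unimodular one with two more
variables. -/
theorem IsPD.exists_transpose_mul_self_of_det {g : Matrix κ κ ℤ} (hg : IsPD g)
    (h4 : g.det % 4 = 1) {b : κ → ℤ} (hb : IsCoprime (qval g.adjugate b) g.det)
    (hκ : Fintype.card κ = 4) : ∃ B : Matrix (Fin 6) κ ℤ, g = Bᵀ * B := by
  have hd := hg.det_pos
  obtain ⟨D, hD⟩ : ∃ D : ℕ, g.det = D := ⟨g.det.toNat, by omega⟩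
  rw [hD] at hb h4 hd
  obtain ⟨m, s, E, hm, hE, c, hc⟩ := exists_prime_dvd_sq_add (by omega) hb
  have hm0 : (0 : ℤ) < m := by exact_mod_cast hm.pos
  -- Two vectors are adjoined: one of norm c with products b, then one of norm m meeting only the
  -- first, with product s. Since c = (s² + E)/m, the first determinant G satisfies mG = s²D + 1,
  -- and the second is mG - s²D = 1.
  have hG := det_border_eq c b (f := g) (by omega)
  rw [hD] at hG
  have hGm : (m : ℤ) * (IntForm.border c b g).det = s ^ 2 * D + 1 := by
    rw [hG]
    linear_combination (D : ℤ) * (-hc) + hE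
  have hGpos : 0 < (IntForm.border c b g).det :=
    pos_of_mul_pos_right (a := (m : ℤ)) (by rw [hGm]; positivity) hm0.le
  have hGPD := hg.border hGpos
  have hH := det_border_eq (m : ℤ) (Pi.single (Sum.inl ()) s) hGpos.ne'
  rw [qval_single, adjugate_border_inl, hGm, hD, add_sub_cancel_left] at hH
  have hHPD := hGPD.border (c := m) (b := Pi.single (Sum.inl ()) s) (by rw [hH]; norm_num)
  obtain ⟨B, hB⟩ := hHPD.exists_eq_transpose_mul_self (n := 6) le_rfl (by simp [hκ]) hH
  refine ⟨B.submatrix id (Sum.inr ∘ Sum.inr), ?_⟩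
  ext i j
  have := congrFun (congrFun hB (Sum.inr (Sum.inr i))) (Sum.inr (Sum.inr j))
  simpa [IntForm.border, Matrix.mul_apply] using this

end IntForm

/-! ### From primitive ternary forms to quaternary forms. -/

namespace IntForm

open Matrix

set_option linter.unusedSectionVars false

variable {ι κ : Type} [Fintype ι] [Fintype κ] [DecidableEq ι] [DecidableEq κ]

theorem exists_forall_prime_dvd_sub (S : Finset ℕ) (hS : ∀ q ∈ S, q.Prime) (t : ℕ → ι → ℤ) :
    ∃ b : ι → ℤ, ∀ q ∈ S, ∀ i, (q : ℤ) ∣ b i - t q i := by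
  induction S using Finset.induction_on with
  | empty => exact ⟨0, by simp⟩
  | insert q S hq ih =>
    obtain ⟨b, hb⟩ := ih fun p hp => hS p (Finset.mem_insert_of_mem hp)
    have hcop : IsCoprime (∏ p ∈ S, (p : ℤ)) (q : ℤ) := by
      refine IsCoprime.prod_left fun p hp => ?_
      rw [Nat.isCoprime_iff_coprime, Nat.coprime_primes (hS p (Finset.mem_insert_of_mem hp))
        (hS q (Finset.mem_insert_self _ _))]
      rintro rfl
      exact hq hp
    obtain ⟨u, v, huv⟩ := hcop
    refine ⟨fun i => b i + u * (∏ p ∈ S, (p : ℤ)) * (t q i - b i), fun p hp i => ?_⟩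
    rcases Finset.mem_insert.1 hp with rfl | hp
    · refine ⟨v * (b i - t p i), ?_⟩
      linear_combination (t p i - b i) * huv
    · obtain ⟨x, hx⟩ := hb p hp i
      obtain ⟨y, hy⟩ := Finset.dvd_prod_of_mem (fun p : ℕ => (p : ℤ)) hp
      refine ⟨x + u * y * (t q i - b i), ?_⟩
      linear_combination hx + (u * (t q i - b i)) * hy

theorem dvd_qval_sub {q : ℤ} (A : Matrix ι ι ℤ) {b t : ι → ℤ} (h : ∀ i, q ∣ b i - t i) :
    q ∣ qval A b - qval A t := by
  rw [← Int.modEq_iff_dvd]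
  have h' : ∀ i, t i ≡ b i [ZMOD q] := fun i => Int.modEq_iff_dvd.2 (h i)
  simp only [qval, dotProduct, Matrix.mulVec]
  exact Int.ModEq.sum fun i _ => (h' i).mul (Int.ModEq.sum fun j _ => (Int.ModEq.refl _).mul (h' j))

/-- By the Chinese remainder theorem, b is made congruent mod each prime of D to a basis vector
whose diagonal entry is nonzero there. -/
theorem exists_isCoprime_qval [Nonempty ι] (A : Matrix ι ι ℤ) {D : ℤ} (hD : D ≠ 0)
    (h : ∀ q : ℕ, q.Prime → (q : ℤ) ∣ D → ∃ i, ¬ (q : ℤ) ∣ A i i) :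
    ∃ b, IsCoprime (qval A b) D := by
  choose! k hk using h
  obtain ⟨b, hb⟩ := exists_forall_prime_dvd_sub D.natAbs.primeFactors
    (fun q hq => Nat.prime_of_mem_primeFactors hq) (fun q => Pi.single (k q) (1 : ℤ))
  refine ⟨b, ?_⟩
  rw [Int.isCoprime_iff_gcd_eq_one]
  by_contra hne
  obtain ⟨q, hq, hqd⟩ := Nat.exists_prime_and_dvd hne
  have h1 : (q : ℤ) ∣ qval A b := (Int.natCast_dvd_natCast.2 hqd).trans (Int.gcd_dvd_left ..)
  have h2 : (q : ℤ) ∣ D := (Int.natCast_dvd_natCast.2 hqd).trans (Int.gcd_dvd_right ..)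
  have hmem : q ∈ D.natAbs.primeFactors := by
    rw [Nat.mem_primeFactors]
    exact ⟨hq, Int.natCast_dvd.1 h2, by simpa using hD⟩
  have h3 := (dvd_sub_right h1).1 (dvd_qval_sub A (hb q hmem))
  rw [qval_single, one_pow, one_mul] at h3
  exact hk q hq h2 h3

variable {f : Matrix (Fin 3) (Fin 3) ℤ}

theorem adjugate_fin_three_diag (f : Matrix (Fin 3) (Fin 3) ℤ) (i : Fin 3) :
    f.adjugate (i + 2) (i + 2) = f i i * f (i + 1) (i + 1) - f i (i + 1) * f (i + 1) i := by
  rw [Matrix.adjugate_fin_three]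
  fin_cases i
  all_goals simp
  all_goals ring

theorem adjugate_border_inr (hf : fᵀ = f) (c : ℤ) (b : Fin 3 → ℤ) (i : Fin 3) :
    (border c b f).adjugate (Sum.inr (i + 2)) (Sum.inr (i + 2)) =
      c * f.adjugate (i + 2) (i + 2) - b i ^ 2 * f (i + 1) (i + 1) - b (i + 1) ^ 2 * f i i
        + 2 * b i * b (i + 1) * f i (i + 1) := by
  have hs : ∀ i j, f j i = f i j := fun i j => congrFun (congrFun hf i) j
  rw [adjugate_fin_three_diag, Matrix.adjugate_apply]
  obtain ⟨e, e0, e1, e2, e3⟩ : ∃ e : Fin 4 ≃ Unit ⊕ Fin 3, e 0 = Sum.inl () ∧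
      e 1 = Sum.inr 0 ∧ e 2 = Sum.inr 1 ∧ e 3 = Sum.inr 2 :=
    ⟨{ toFun := Fin.cons (Sum.inl ()) Sum.inr
       invFun := Sum.elim (fun _ => 0) Fin.succ
       left_inv := fun i => by cases i using Fin.cases; all_goals simp
       right_inv := fun i => by rcases i with i | i <;> simp }, rfl, rfl, rfl, rfl⟩
  rw [← Matrix.det_submatrix_equiv_self e, Matrix.det_succ_row_zero]
  have h1 := hs 0 1
  have h2 := hs 0 2
  have h3 := hs 1 2
  fin_cases i <;>
    simp [Fin.sum_univ_succ, Matrix.det_fin_three, Matrix.updateRow_apply, border, e0, e1, e2, e3,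
      h1, h2, h3, Fin.succAbove] <;>
    ring

/-- Jacobi's identity for complementary minors, with indices cyclic mod 3. -/
theorem adjugate_fin_three_minor (hf : fᵀ = f) (i : Fin 3) :
    f.adjugate (i + 1) (i + 1) * f.adjugate (i + 2) (i + 2) - f.adjugate (i + 1) (i + 2) ^ 2 =
      f.det * f i i := by
  have hs : ∀ i j, f j i = f i j := fun i j => congrFun (congrFun hf i) j
  have h1 := hs 0 1
  have h2 := hs 0 2
  have h3 := hs 1 2
  rw [Matrix.adjugate_fin_three, Matrix.det_fin_three]
  fin_cases i <;> simp [h1, h2, h3] <;> ring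

/-- If the diagonal and the principal 2×2 minors vanish mod q, so do the squares of the off-diagonal
entries. -/
theorem exists_not_dvd_diag (hf : fᵀ = f) {q : ℕ} (hq : q.Prime)
    (h : ∃ i j, ¬ (q : ℤ) ∣ f i j) (hadj : ∀ i, (q : ℤ) ∣ f.adjugate i i) :
    ∃ i, ¬ (q : ℤ) ∣ f i i := by
  by_contra! hall
  have key : ∀ i, (q : ℤ) ∣ f i (i + 1) := by
    intro i
    have h1 := hadj (i + 2)
    rw [adjugate_fin_three_diag] at h1
    have h2 := (dvd_sub_right ((hall i).mul_right _)).1 h1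
    have hs : f (i + 1) i = f i (i + 1) := congrFun (congrFun hf i) (i + 1)
    rw [hs] at h2
    rcases (Nat.prime_iff_prime_int.1 hq).dvd_or_dvd h2 with h3 | h3 <;> exact h3
  obtain ⟨i, j, hij⟩ := h
  have hs : ∀ i j, f j i = f i j := fun i j => congrFun (congrFun hf i) j
  apply hij
  have k0 := key 0
  have k1 := key 1
  have k2 := key 2
  have a0 := hall 0
  have a1 := hall 1
  have a2 := hall 2
  have s01 := hs 0 1
  have s02 := hs 0 2
  have s12 := hs 1 2
  simp only [Fin.isValue, zero_add, Fin.reduceAdd] at k0 k1 k2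
  fin_cases i <;> fin_cases j <;> simp only [Fin.zero_eta, Fin.mk_one, Fin.reduceFinMk, Fin.isValue]
    <;> first | assumption | (rw [hs]; assumption)

/-- Otherwise some f i i is odd, and Jacobi's identity with an even determinant makes the
off-diagonal cofactor even too, so 4 divides det f · f i i. -/
theorem exists_adjugate_diag_not_even (hf : fᵀ = f) (h : ∃ i j, ¬ (2 : ℤ) ∣ f i j)
    (h2 : (2 : ℤ) ∣ f.det) (h4 : ¬ (4 : ℤ) ∣ f.det) : ∃ i, ¬ (2 : ℤ) ∣ f.adjugate i i := by
  by_contra! hall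
  obtain ⟨i, hi⟩ := exists_not_dvd_diag hf Nat.prime_two (by exact_mod_cast h)
    (by exact_mod_cast hall)
  have key := adjugate_fin_three_minor hf i
  obtain ⟨x, hx⟩ := hall (i + 1)
  obtain ⟨y, hy⟩ := hall (i + 2)
  rw [hx, hy] at key
  push_cast at hi
  apply h4
  have hcop : IsCoprime (4 : ℤ) (f i i) := by
    have : IsCoprime (2 : ℤ) (f i i) :=
      (Int.prime_two.coprime_iff_not_dvd).2 hi
    simpa using this.pow_left (m := 2)
  refine hcop.dvd_of_dvd_mul_right ?_
  obtain ⟨z, hz⟩ : (2 : ℤ) ∣ f.adjugate (i + 1) (i + 2) := by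
    refine Int.prime_two.dvd_of_dvd_pow (n := 2) ?_
    obtain ⟨w, hw⟩ := h2
    exact ⟨2 * x * y - w * f i i, by rw [hw] at key; linarith⟩
  exact ⟨x * y - z ^ 2, by rw [hz] at key; linarith⟩

/-- Data at a prime for extending a ternary form by one variable. -/
theorem exists_local_vector (hf : fᵀ = f) {q : ℕ} (hq : q.Prime)
    (h : ∃ i j, ¬ (q : ℤ) ∣ f i j) :
    ∃ t : Fin 3 → ℤ, (∃ i, t = Pi.single i 1 ∧ ¬ (q : ℤ) ∣ f.adjugate i i) ∨
      ((∀ i, (q : ℤ) ∣ f.adjugate i i) ∧ ∃ i, t = Pi.single (i + 1) 1 ∧ ¬ (q : ℤ) ∣ f i i) := by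
  by_cases hadj : ∀ i, (q : ℤ) ∣ f.adjugate i i
  · obtain ⟨i, hi⟩ := exists_not_dvd_diag hf hq h hadj
    exact ⟨_, Or.inr ⟨hadj, i, rfl, hi⟩⟩
  · push Not at hadj
    obtain ⟨i, hi⟩ := hadj
    exact ⟨_, Or.inl ⟨i, rfl, hi⟩⟩

/-- Here c d - N is the determinant of the extended form; the congruence can be solved because d² ≡
1 mod 4 or N is odd, and adding a multiple of 4 to c gives positivity. -/
theorem exists_corner {d N : ℤ} (hd : 0 < d) (h : d % 2 = 1 ∨ d % 4 = 2 ∧ N % 2 = 1) :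
    ∃ c : ℤ, 0 < c * d - N ∧ (c * d - N) % 4 = 1 := by
  obtain ⟨c, hc⟩ : ∃ c : ℤ, (c * d - N) % 4 = 1 := by
    rcases h with h | ⟨h, hN⟩
    · refine ⟨d * (1 + N), ?_⟩
      obtain ⟨k, hk⟩ : ∃ k, d = 2 * k + 1 := ⟨d / 2, by omega⟩
      have : d * (1 + N) * d - N = 1 + 4 * ((k ^ 2 + k) * (1 + N)) := by rw [hk]; ring
      omega
    · obtain ⟨k, hk⟩ : ∃ k, d = 4 * k + 2 := ⟨d / 4, by omega⟩
      obtain ⟨l, hl⟩ : ∃ l, N = 2 * l + 1 := ⟨N / 2, by omega⟩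
      refine ⟨l + 1, ?_⟩
      have : (l + 1) * d - N = 1 + 4 * (k * (l + 1)) := by rw [hk, hl]; ring
      omega
  refine ⟨c + 4 * (|c * d - N|), ?_, ?_⟩
  · have h0 := neg_abs_le (c * d - N)
    have h1 := abs_nonneg (c * d - N)
    have h2 : c * d - N ≠ 0 := by omega
    have h3 := abs_pos.2 h2
    nlinarith
  · have : (c + 4 * |c * d - N|) * d - N = c * d - N + 4 * (|c * d - N| * d) := by ring
    omega

/-- Sufficiently primitive positive definite ternary forms are sums of six squares. -/
theorem IsPD.exists_transpose_mul_self_of_primitive (hf : IsPD f) (h4 : ¬ (4 : ℤ) ∣ f.det)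
    (h : ∀ q : ℕ, q.Prime → (q : ℤ) ∣ f.det → ∃ i j, ¬ (q : ℤ) ∣ f i j) :
    ∃ B : Matrix (Fin 6) (Fin 3) ℤ, f = Bᵀ * B := by
  have hd := hf.det_pos
  choose! t ht using fun (q : ℕ) (hq : q.Prime) (hqd : (q : ℤ) ∣ f.det) =>
    exists_local_vector hf.symm hq (h q hq hqd)
  obtain ⟨b, hb⟩ := exists_forall_prime_dvd_sub f.det.natAbs.primeFactors
    (fun q hq => Nat.prime_of_mem_primeFactors hq) t
  have hb' : ∀ q : ℕ, q.Prime → (q : ℤ) ∣ f.det → ∀ i, (q : ℤ) ∣ b i - t q i := by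
    intro q hq hqd
    refine hb q ?_
    rw [Nat.mem_primeFactors]
    exact ⟨hq, Int.natCast_dvd.1 hqd, by simpa using hd.ne'⟩
  set N := qval f.adjugate b with hN
  have hfirst : ∀ q : ℕ, q.Prime → (q : ℤ) ∣ f.det → (∃ i, ¬ (q : ℤ) ∣ f.adjugate i i) →
      ¬ (q : ℤ) ∣ N := by
    rintro q hq hqd ⟨j, hj⟩ hqN
    rcases ht q hq hqd with ⟨i, hti, hi⟩ | ⟨hall, -⟩
    · have h1 := (dvd_sub_right hqN).1 (dvd_qval_sub f.adjugate (hb' q hq hqd))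
      rw [hti, qval_single, one_pow, one_mul] at h1
      exact hi h1
    · exact hj (hall j)
  obtain ⟨c, hc0, hc1⟩ := exists_corner (N := N) hd (by
    by_cases h2 : (2 : ℤ) ∣ f.det
    · right
      have h3 := hfirst 2 Nat.prime_two (by exact_mod_cast h2) (by
        exact_mod_cast exists_adjugate_diag_not_even hf.symm
          (by exact_mod_cast h 2 Nat.prime_two (by exact_mod_cast h2)) h2 h4)
      push_cast at h3
      omega
    · left; omega)
  have hdet := det_border_eq c b hd.ne'
  rw [← hN] at hdet
  rw [← hdet] at hc0 hc1
  have hg := hf.border hc0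
  -- For q dividing the new determinant, a diagonal cofactor prime to q is needed. If q ∤ det f, it
  -- is det f itself. Otherwise q ∣ N, so the diagonal of adj f vanishes mod q, and with b ≡ e_(i+1)
  -- one cofactor is ≡ -f i i.
  obtain ⟨b', hb''⟩ := exists_isCoprime_qval (IntForm.border c b f).adjugate hc0.ne' (by
    intro q hq hqD
    by_cases hqd : (q : ℤ) ∣ f.det
    · rw [hdet] at hqD
      have hqN : (q : ℤ) ∣ N := (dvd_sub_right (hqd.mul_left c)).1 hqD
      rcases ht q hq hqd with ⟨i, hti, hi⟩ | ⟨hall, i, hti, hi⟩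
      · exact absurd hqN (hfirst q hq hqd ⟨i, hi⟩)
      · refine ⟨Sum.inr (i + 2), ?_⟩
        rw [adjugate_border_inr hf.symm]
        obtain ⟨x, hx⟩ := hall (i + 2)
        obtain ⟨y, hy⟩ := hb' q hq hqd i
        obtain ⟨z, hz⟩ := hb' q hq hqd (i + 1)
        have hne : i ≠ i + 1 := by fin_cases i <;> decide
        rw [hti, Pi.single_eq_of_ne hne] at hy
        rw [hti, Pi.single_eq_same] at hz
        have hy' : b i = q * y := by linarith
        have hz' : b (i + 1) = 1 + q * z := by linarith
        rw [hx, hy', hz']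
        rintro ⟨w, hw⟩
        refine hi ⟨c * x - q * y ^ 2 * f (i + 1) (i + 1) - (2 * z + q * z ^ 2) * f i i +
          2 * y * (1 + q * z) * f i (i + 1) - w, ?_⟩
        linear_combination -hw
    · exact ⟨Sum.inl (), by rwa [adjugate_border_inl]⟩)
  obtain ⟨B, hB⟩ := hg.exists_transpose_mul_self_of_det hc1 hb'' (by simp)
  refine ⟨B.submatrix id Sum.inr, ?_⟩
  ext i j
  have := congrFun (congrFun hB (Sum.inr i)) (Sum.inr j)
  simpa [IntForm.border, Matrix.mul_apply] using this

end IntForm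

/-! ### Overlattices and the passage to arbitrary ternary Gram matrices. -/

namespace IntForm

open Matrix

set_option linter.unusedSectionVars false

variable {ι κ : Type} [Fintype ι] [Fintype κ] [DecidableEq ι] [DecidableEq κ]

/-- Passing to the overlattice generated by `v / q`. -/
theorem IsPD.exists_overlattice {f : Matrix ι ι ℤ} (hf : IsPD f) {q : ℤ} (hq : 1 < q)
    {v : ι → ℤ} {i : ι} (hvi : v i = 1) (hv : ∀ j, q ∣ (f *ᵥ v) j) (hvv : q ^ 2 ∣ qval f v) :
    ∃ f' M : Matrix ι ι ℤ, IsPD f' ∧ f = Mᵀ * f' * M ∧ f'.det < f.det := by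
  -- P/q is a basis of the overlattice and M its inverse, so f' = PᵀfP/q² and det f = q² det f'. The
  -- hypotheses on v are what makes f' integral.
  set P : Matrix ι ι ℤ := (q • (1 : Matrix ι ι ℤ)).updateCol i v with hP
  set M : Matrix ι ι ℤ := (1 : Matrix ι ι ℤ).updateCol i (fun k => if k = i then q else -v k)
    with hM
  have hPM : P * M = q • (1 : Matrix ι ι ℤ) := by
    have hPw : ∀ (w : ι → ℤ) j, (P *ᵥ w) j = v j * w i + if j = i then 0 else q * w j := by
      intro w j
      have hPjk : ∀ k, P j k * w k =
          (if k = i then v j * w i else 0) +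
            if k = j then (if j = i then 0 else q * w j) else 0 := by
        intro k
        rw [hP, Matrix.updateCol_apply]
        by_cases hki : k = i
        · subst hki
          by_cases hkj : k = j
          · subst hkj; simp
          · simp [hkj]
        · by_cases hkj : k = j
          · subst hkj; simp [hki]
          · simp [hki, hkj, Ne.symm hkj]
      rw [Matrix.mulVec, dotProduct, Finset.sum_congr rfl fun k _ => hPjk k,
        Finset.sum_add_distrib]
      simp
    ext j k
    change (P *ᵥ fun l => M l k) j = _
    rw [hPw, hM, Matrix.updateCol_apply, Matrix.updateCol_apply]
    by_cases hki : k = i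
    · subst hki
      by_cases hjk : j = k
      · subst hjk; simp [hvi]
      · simp [hjk]; ring
    · by_cases hji : j = i
      · subst hji; simp [hki, Ne.symm hki]
      · simp [hki, hji, Matrix.one_apply, Ne.symm hki]
  have hMdet : M.det = q := by
    rw [hM, ← Matrix.cramer_apply, Matrix.cramer_one]
    simp
  have hdvd : ∀ j k, q ^ 2 ∣ (Pᵀ * f * P) j k := by
    have hcol : ∀ j, P.col j = if j = i then v else q • Pi.single j 1 := by
      intro j
      funext a
      rw [Matrix.col_apply, hP, Matrix.updateCol_apply]
      by_cases hj : j = i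
      · simp [hj]
      · simp [hj, Matrix.one_apply, Pi.single_apply]
    intro j k
    have hjk : (Pᵀ * f * P) j k = P.col j ⬝ᵥ f *ᵥ P.col k := by
      rw [Matrix.mul_assoc]
      rfl
    rw [hjk, hcol, hcol]
    by_cases hji : j = i
    · by_cases hki : k = i
      · rwa [if_pos hji, if_pos hki]
      · rw [if_pos hji, if_neg hki, Matrix.mulVec_smul, dotProduct_smul, smul_eq_mul, pow_two,
          Matrix.dotProduct_mulVec, ← Matrix.mulVec_transpose, hf.symm, dotProduct_single_one]
        exact mul_dvd_mul_left q (hv k)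
    · by_cases hki : k = i
      · rw [if_neg hji, if_pos hki, smul_dotProduct, smul_eq_mul, pow_two, single_one_dotProduct]
        exact mul_dvd_mul_left q (hv j)
      · rw [if_neg hji, if_neg hki, Matrix.mulVec_smul, dotProduct_smul, smul_dotProduct,
          smul_eq_mul, smul_eq_mul, ← mul_assoc, pow_two]
        exact dvd_mul_right _ _
  choose f' hf' using hdvd
  have hq0 : q ^ 2 ≠ 0 := by positivity
  have hf'' : Pᵀ * f * P = q ^ 2 • (Matrix.of f') := by
    ext j k
    rw [hf']
    simp
  have hfM : f = Mᵀ * Matrix.of f' * M := by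
    have h1 : q ^ 2 • (Mᵀ * Matrix.of f' * M) = q ^ 2 • f := by
      calc q ^ 2 • (Mᵀ * Matrix.of f' * M) = Mᵀ * (q ^ 2 • Matrix.of f') * M := by rw [Matrix.mul_smul, Matrix.smul_mul]
        _ = (P * M)ᵀ * f * (P * M) := by
          rw [← hf'', Matrix.transpose_mul]; simp only [Matrix.mul_assoc]
        _ = q ^ 2 • f := by
          rw [hPM, Matrix.transpose_smul, Matrix.transpose_one, pow_two, mul_smul]
          rw [Matrix.smul_mul, Matrix.one_mul, Matrix.mul_smul, Matrix.mul_one]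
    exact (smul_right_injective _ hq0 h1).symm
  have hPinj : ∀ y, P *ᵥ y = 0 → y = 0 := by
    intro y hy
    refine Matrix.eq_zero_of_mulVec_eq_zero (M := P) (fun h0 => ?_) hy
    have := congrArg Matrix.det hPM
    rw [Matrix.det_mul, h0, zero_mul, Matrix.det_smul, Matrix.det_one, mul_one] at this
    exact pow_ne_zero _ (by omega) this.symm
  have hPD : IsPD (Matrix.of f') := by
    have h1 := hf.conj hPinj
    rw [hf''] at h1
    refine ⟨?_, fun y hy => ?_⟩
    · have h2 := h1.symm
      rw [Matrix.transpose_smul] at h2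
      exact smul_right_injective _ hq0 h2
    · have h2 := h1.pos y hy
      simp only [qval, Matrix.smul_mulVec, dotProduct_smul, smul_eq_mul] at h2 ⊢
      exact pos_of_mul_pos_right h2 (by positivity)
  refine ⟨_, M, hPD, hfM, ?_⟩
  have h3 := congrArg Matrix.det hfM
  rw [Matrix.det_mul, Matrix.det_mul, Matrix.det_transpose, hMdet] at h3
  have h4 := hPD.det_pos
  have h5 : 1 < q * q := by nlinarith
  rw [h3]
  nlinarith

/-- Chevalley–Warning: degree 2 in three variables has a nontrivial zero mod q, scaled here to have
a coordinate 1. -/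
theorem exists_qval_dvd (h : Matrix (Fin 3) (Fin 3) ℤ) {q : ℕ} (hq : q.Prime) :
    ∃ (v : Fin 3 → ℤ) (i : Fin 3), v i = 1 ∧ (q : ℤ) ∣ qval h v := by
  have : Fact q.Prime := ⟨hq⟩
  set p : MvPolynomial (Fin 3) (ZMod q) :=
    ∑ i, ∑ j, MvPolynomial.C (h i j : ZMod q) * (MvPolynomial.X i * MvPolynomial.X j) with hp
  have hdeg : p.totalDegree < Fintype.card (Fin 3) := by
    refine lt_of_le_of_lt (b := 2) ?_ (by simp)
    refine MvPolynomial.totalDegree_finsetSum_le fun i _ =>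
      MvPolynomial.totalDegree_finsetSum_le fun j _ => ?_
    refine (MvPolynomial.totalDegree_mul _ _).trans ?_
    rw [MvPolynomial.totalDegree_C, zero_add]
    refine (MvPolynomial.totalDegree_mul _ _).trans ?_
    rw [MvPolynomial.totalDegree_X, MvPolynomial.totalDegree_X]
  have hev : ∀ x : Fin 3 → ZMod q, MvPolynomial.eval x p = ∑ i, ∑ j, (h i j : ZMod q) * (x i * x j) := by
    intro x
    simp [hp]
  have hcard := char_dvd_card_solutions q hdeg
  obtain ⟨w, hw0, hw⟩ : ∃ w : Fin 3 → ZMod q, w ≠ 0 ∧ MvPolynomial.eval w p = 0 := by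
    by_contra! hcon
    have h1 : Fintype.card { x : Fin 3 → ZMod q // MvPolynomial.eval x p = 0 } = 1 := by
      rw [Fintype.card_eq_one_iff]
      refine ⟨⟨0, by rw [hev]; simp⟩, fun x => Subtype.ext ?_⟩
      by_contra hx
      exact hcon x.1 hx x.2
    rw [h1] at hcard
    exact hq.one_lt.ne' (Nat.dvd_one.1 hcard)
  obtain ⟨i, hi⟩ := Function.ne_iff.1 hw0
  have hi' : w i ≠ 0 := hi
  refine ⟨fun j => ((w j / w i).val : ℤ), i, ?_, ?_⟩
  · simp only [div_self hi']
    rw [ZMod.val_one]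
    rfl
  · rw [← ZMod.intCast_zmod_eq_zero_iff_dvd]
    simp only [qval, dotProduct, Matrix.mulVec, Int.cast_sum, Int.cast_mul, Int.cast_natCast,
      Finset.mul_sum, ZMod.natCast_rightInverse (_ : ZMod q)]
    have h2 : ∑ j, ∑ k, (w j / w i) * ((h j k : ZMod q) * (w k / w i)) =
        (∑ j, ∑ k, (h j k : ZMod q) * (w j * w k)) / (w i * w i) := by
      rw [Finset.sum_div]
      refine Finset.sum_congr rfl fun j _ => ?_
      rw [Finset.sum_div]
      refine Finset.sum_congr rfl fun k _ => ?_
      field_simp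
    rw [h2, ← hev, hw, zero_div]

/-- A finite check suffices: mod 4 the determinant depends only on the diagonal mod 4 and the other
entries mod 2. The 3 stands for -1, and squares of bits are dropped. -/
theorem exists_two_adic_vector_aux : ∀ (a b c : Fin 4) (x y z : Fin 2),
    (a.val * b * c + 2 * x * y * z + 3 * (a * z + b * y + c * x)) % 4 = 0 →
    ∃ u v w : Fin 2, (u = 1 ∨ v = 1 ∨ w = 1) ∧
      (a.val * u + x * v + y * w) % 2 = 0 ∧ (x.val * u + b * v + z * w) % 2 = 0 ∧
      (y.val * u + z * v + c * w) % 2 = 0 ∧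
      (a.val * u + b * v + c * w + 2 * (x * u * v + y * u * w + z * v * w)) % 4 = 0 := by
  decide +kernel

theorem exists_two_adic_vector {f : Matrix (Fin 3) (Fin 3) ℤ} (hf : fᵀ = f)
    (h4 : (4 : ℤ) ∣ f.det) :
    ∃ (v : Fin 3 → ℤ) (i : Fin 3), v i = 1 ∧ (∀ j, 2 ∣ (f *ᵥ v) j) ∧ 2 ^ 2 ∣ qval f v := by
  have hs : ∀ i j, f j i = f i j := fun i j => congrFun (congrFun hf i) j
  have h1 := hs 0 1
  have h2 := hs 0 2
  have h3 := hs 1 2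
  rw [Matrix.det_fin_three, h1, h2, h3] at h4
  have hdiag : ∀ t : ℤ, ∃ (a : Fin 4) (A : ℤ), t = a.val + 4 * A := fun t =>
    ⟨⟨(t % 4).toNat, by omega⟩, t / 4, by dsimp only; omega⟩
  have hoff : ∀ t : ℤ, ∃ (a : Fin 2) (A : ℤ), t = a.val + 2 * A := fun t =>
    ⟨⟨(t % 2).toNat, by omega⟩, t / 2, by dsimp only; omega⟩
  have hidem : ∀ t : Fin 2, ((t.val : ℤ)) ^ 2 = t.val := by decide
  obtain ⟨a, A, ha⟩ := hdiag (f 0 0)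
  obtain ⟨b, B, hb⟩ := hdiag (f 1 1)
  obtain ⟨c, C, hc⟩ := hdiag (f 2 2)
  obtain ⟨x, X, hx⟩ := hoff (f 0 1)
  obtain ⟨y, Y, hy⟩ := hoff (f 0 2)
  obtain ⟨z, Z, hz⟩ := hoff (f 1 2)
  have hx2 := hidem x
  have hy2 := hidem y
  have hz2 := hidem z
  obtain ⟨u, v, w, huvw, e1, e2, e3, e4⟩ := exists_two_adic_vector_aux a b c x y z (by
    rw [ha, hb, hc, hx, hy, hz] at h4
    obtain ⟨k, hk⟩ := h4
    refine Nat.mod_eq_zero_of_dvd (Int.natCast_dvd_natCast.1 ?_)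
    push_cast
    refine ⟨k + a.val * z.val + b.val * y.val + c.val * x.val
      - (A * (b.val + 4 * B) * (c.val + 4 * C) + a.val * B * (c.val + 4 * C) + a.val * b.val * C)
      - (X * (y.val + 2 * Y) * (z.val + 2 * Z) + x.val * Y * (z.val + 2 * Z) + x.val * y.val * Z)
      + ((a.val + 4 * A) * (z.val * Z + Z ^ 2) + A * z.val)
      + ((b.val + 4 * B) * (y.val * Y + Y ^ 2) + B * y.val)
      + ((c.val + 4 * C) * (x.val * X + X ^ 2) + C * x.val), ?_⟩
    linear_combination hk + (a.val + 4 * A) * hz2 + (b.val + 4 * B) * hy2 + (c.val + 4 * C) * hx2)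
  have hu2 := hidem u
  have hv2 := hidem v
  have hw2 := hidem w
  have hmul : ∀ j, (f *ᵥ ![(u.val : ℤ), v.val, w.val]) j =
      f j 0 * u.val + f j 1 * v.val + f j 2 * w.val := by
    intro j
    simp [Matrix.mulVec, dotProduct, Fin.sum_univ_three]
  obtain ⟨i, hi⟩ : ∃ i, (![(u.val : ℤ), v.val, w.val] : Fin 3 → ℤ) i = 1 := by
    rcases huvw with h | h | h
    · exact ⟨0, by simp [h]⟩
    · exact ⟨1, by simp [h]⟩
    · exact ⟨2, by simp [h]⟩
  have g1 := Int.natCast_dvd_natCast.2 (Nat.dvd_of_mod_eq_zero e1)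
  have g2 := Int.natCast_dvd_natCast.2 (Nat.dvd_of_mod_eq_zero e2)
  have g3 := Int.natCast_dvd_natCast.2 (Nat.dvd_of_mod_eq_zero e3)
  have g4 := Int.natCast_dvd_natCast.2 (Nat.dvd_of_mod_eq_zero e4)
  push_cast at g1 g2 g3 g4
  refine ⟨_, i, hi, fun j => ?_, ?_⟩
  · rw [hmul]
    fin_cases j
    · obtain ⟨k, hk⟩ := g1
      exact ⟨k + 2 * A * u.val + X * v.val + Y * w.val, by
        simp only [Fin.zero_eta, Fin.isValue, ha, hx, hy]; linear_combination hk⟩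
    · obtain ⟨k, hk⟩ := g2
      exact ⟨k + X * u.val + 2 * B * v.val + Z * w.val, by
        simp only [Fin.mk_one, Fin.isValue, h1, hb, hx, hz]; linear_combination hk⟩
    · obtain ⟨k, hk⟩ := g3
      exact ⟨k + Y * u.val + Z * v.val + 2 * C * w.val, by
        simp only [Fin.reduceFinMk, Fin.isValue, h2, h3, hc, hy, hz]; linear_combination hk⟩
  · obtain ⟨k, hk⟩ := g4
    simp only [qval, dotProduct, Fin.sum_univ_three, hmul]
    refine ⟨k + A * u.val + B * v.val + C * w.val + X * u.val * v.val + Y * u.val * w.val +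
      Z * v.val * w.val, ?_⟩
    simp only [Matrix.cons_val_zero, Matrix.cons_val_one, Matrix.cons_val, h1, h2, h3, ha, hb, hc,
      hx, hy, hz]
    linear_combination hk + (a.val + 4 * A) * hu2 + (b.val + 4 * B) * hv2 + (c.val + 4 * C) * hw2

/-- Positive definite ternary forms are sums of six squares of linear forms. -/
theorem IsPD.exists_transpose_mul_self {f : Matrix (Fin 3) (Fin 3) ℤ} (hf : IsPD f) :
    ∃ B : Matrix (Fin 6) (Fin 3) ℤ, f = Bᵀ * B := by
  induction hn : f.det.toNat using Nat.strong_induction_on generalizing f with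
  | _ n ih =>
  subst hn
  have hd := hf.det_pos
  -- Descent on the determinant. It applies with q = 2 when 4 ∣ det f, and when f = q h, where a
  -- zero v of h mod q gives q² ∣ f(v).
  have step : ∀ (q : ℤ) (v : Fin 3 → ℤ) (i : Fin 3), 1 < q → v i = 1 →
      (∀ j, q ∣ (f *ᵥ v) j) → q ^ 2 ∣ qval f v → ∃ B : Matrix (Fin 6) (Fin 3) ℤ, f = Bᵀ * B := by
    intro q v i hq hvi hv hvv
    obtain ⟨f', M, hf', hfM, hlt⟩ := hf.exists_overlattice hq hvi hv hvv
    obtain ⟨B, hB⟩ := ih _ (by have := hf'.det_pos; omega) hf' rfl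
    exact ⟨B * M, by rw [hfM, hB, Matrix.transpose_mul]; simp only [Matrix.mul_assoc]⟩
  by_cases h4 : (4 : ℤ) ∣ f.det
  · obtain ⟨v, i, hvi, hv, hvv⟩ := exists_two_adic_vector hf.symm h4
    exact step 2 v i (by norm_num) hvi hv hvv
  by_cases hprim : ∀ q : ℕ, q.Prime → (q : ℤ) ∣ f.det → ∃ i j, ¬ (q : ℤ) ∣ f i j
  · exact hf.exists_transpose_mul_self_of_primitive h4 hprim
  push Not at hprim
  obtain ⟨q, hq, -, hall⟩ := hprim
  choose h hh using hall
  have hfh : f = (q : ℤ) • Matrix.of h := by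
    ext i j
    rw [hh]; simp
  obtain ⟨v, i, hvi, hv⟩ := exists_qval_dvd (Matrix.of h) hq
  refine step q v i (by exact_mod_cast hq.one_lt) hvi (fun j => ?_) ?_
  · rw [hfh, Matrix.smul_mulVec]
    exact dvd_mul_right _ _
  · rw [hfh, qval, Matrix.smul_mulVec, dotProduct_smul, smul_eq_mul, pow_two]
    exact mul_dvd_mul_left _ hv

theorem isPD_one : IsPD (1 : Matrix ι ι ℤ) where
  symm := Matrix.transpose_one
  pos v hv := by
    rw [qval, Matrix.one_mulVec]
    exact lt_of_le_of_ne (Finset.sum_nonneg fun i _ => mul_self_nonneg (v i))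
      (Ne.symm (dotProduct_self_eq_zero.not.2 hv))

/-- A sum of squares of integral linear forms in three variables is a sum of six such squares. -/
theorem exists_six_squares (A : Matrix ι (Fin 3) ℤ) :
    ∃ B : Matrix (Fin 6) (Fin 3) ℤ, Aᵀ * A = Bᵀ * B := by
  set L := LinearMap.range A.mulVecLin
  set r := Module.finrank ℤ L
  have hr : r ≤ 3 := by simpa using LinearMap.finrank_range_le A.mulVecLin
  let β := Module.finBasis ℤ L
  let C : Matrix ι (Fin r) ℤ := Matrix.of fun i k => (β k : ι → ℤ) i
  let T : Matrix (Fin r) (Fin 3) ℤ := Matrix.of fun k j =>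
    β.repr ⟨A *ᵥ Pi.single j 1, LinearMap.mem_range_self A.mulVecLin _⟩ k
  have hCy : ∀ y, C *ᵥ y = ((∑ k, y k • β k : L) : ι → ℤ) := by
    intro y
    funext i
    simp [C, Matrix.mulVec, dotProduct, mul_comm]
  have hCinj : ∀ y, C *ᵥ y = 0 → y = 0 := by
    intro y hy
    rw [hCy] at hy
    exact funext (Fintype.linearIndependent_iff.1 β.linearIndependent y (Subtype.ext hy))
  have hA : A = C * T := by
    ext i j
    have h1 : C *ᵥ (fun k => T k j) = A *ᵥ Pi.single j 1 := by
      rw [hCy]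
      exact congrArg Subtype.val (β.sum_repr _)
    have h2 := congrFun h1 i
    rw [Matrix.mulVec_single_one] at h2
    exact h2.symm
  -- The columns of A may be dependent, so A is factored through a basis C of its image, and C is
  -- padded by an identity block to give a definite form in exactly three variables.
  let W : Matrix (ι ⊕ Fin (3 - r)) (Fin r ⊕ Fin (3 - r)) ℤ := fromBlocks C 0 0 1
  have hWinj : ∀ y, W *ᵥ y = 0 → y = 0 := by
    intro y hy
    rw [Matrix.fromBlocks_mulVec] at hy
    funext k
    rcases k with k | k
    · have h1 : C *ᵥ (y ∘ Sum.inl) = 0 := by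
        funext i
        simpa using congrFun hy (Sum.inl i)
      exact congrFun (hCinj _ h1) k
    · simpa using congrFun hy (Sum.inr k)
  let e : Fin 3 ≃ Fin r ⊕ Fin (3 - r) := Fintype.equivOfCardEq (by simp; omega)
  have hPD := ((isPD_one (ι := ι ⊕ Fin (3 - r))).conj hWinj).submatrix e
  obtain ⟨B, hB⟩ := hPD.exists_transpose_mul_self
  let S : Matrix (Fin r ⊕ Fin (3 - r)) (Fin 3) ℤ := fromRows T 0
  have hB' : Wᵀ * W = (B.submatrix id e.symm)ᵀ * B.submatrix id e.symm := by
    have h1 := congrArg (fun X => X.submatrix e.symm e.symm) hB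
    simp only [Matrix.mul_one, Matrix.submatrix_submatrix, Equiv.self_comp_symm,
      Matrix.submatrix_id_id] at h1
    rw [h1]
    rfl
  have hWS : W * S = fromRows A 0 := by
    simp only [W, S, Matrix.fromBlocks_mul_fromRows, hA]
    simp
  refine ⟨B.submatrix id e.symm * S, ?_⟩
  calc Aᵀ * A = (W * S)ᵀ * (W * S) := by
        rw [hWS, Matrix.transpose_fromRows, Matrix.fromCols_mul_fromRows]; simp
    _ = Sᵀ * (Wᵀ * W) * S := by rw [Matrix.transpose_mul]; simp only [Matrix.mul_assoc]
    _ = _ := by rw [hB', Matrix.transpose_mul]; simp only [Matrix.mul_assoc]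

end IntForm

/-! ### Lower bound: norm 7 and the rigidity of the Gram matrix. -/

section SumOfThreeSquares

theorem sum_sq_ne_seven_of_card_le_three {ι : Type*} {s : Finset ι} (hs : s.card ≤ 3)
    (x : ι → ℤ) : ∑ i ∈ s, x i ^ 2 ≠ 7 := by
  classical
  have key : ∀ a b c : ℤ, a ^ 2 + b ^ 2 + c ^ 2 ≠ 7 := by
    intro a b c h
    have h8 : ∀ a b c : ZMod 8, a ^ 2 + b ^ 2 + c ^ 2 ≠ 7 := by decide +kernel
    exact h8 a b c (by exact_mod_cast congrArg (Int.cast : ℤ → ZMod 8) h)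
  obtain h | h | h | h : s.card = 0 ∨ s.card = 1 ∨ s.card = 2 ∨ s.card = 3 := by omega
  · rw [Finset.card_eq_zero] at h
    simp [h]
  · obtain ⟨i, rfl⟩ := Finset.card_eq_one.1 h
    simpa using key (x i) 0 0
  · obtain ⟨i, j, hij, rfl⟩ := Finset.card_eq_two.1 h
    simpa [Finset.sum_pair hij] using key (x i) (x j) 0
  · obtain ⟨i, j, k, hij, hik, hjk, rfl⟩ := Finset.card_eq_three.1 h
    rw [Finset.sum_insert (by simp [hij, hik]), Finset.sum_pair hjk, ← add_assoc]
    exact key _ _ _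

open Matrix

theorem exists_eq_zero_of_dotProduct_self_eq_one {ι : Type*} [Fintype ι] {y : ι → ℤ}
    (hy : y ⬝ᵥ y = 1) : ∃ i, y i ≠ 0 ∧ ∀ j, j ≠ i → y j = 0 := by
  classical
  have h0 : y ≠ 0 := by rintro rfl; simp at hy
  obtain ⟨i, hi⟩ := Function.ne_iff.1 h0
  have hi' : y i ≠ 0 := hi
  refine ⟨i, hi', fun j hj => ?_⟩
  by_contra hyj
  have h1 : ∑ k ∈ {i, j}, y k * y k ≤ y ⬝ᵥ y :=
    Finset.sum_le_sum_of_subset_of_nonneg (Finset.subset_univ _) fun k _ _ => mul_self_nonneg _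
  rw [Finset.sum_pair hj.symm, hy] at h1
  have h2 := mul_self_pos.2 hi'
  have h3 := mul_self_pos.2 hyj
  omega

/-- Integral unit vectors are signed coordinate vectors, so x lives on at most three coordinates,
and 7 is not a sum of three squares mod 8. -/
theorem dotProduct_self_ne_seven {n : ℕ} (hn : n ≤ 5) {x y z : Fin n → ℤ} (hy : y ⬝ᵥ y = 1)
    (hz : z ⬝ᵥ z = 1) (hxy : x ⬝ᵥ y = 0) (hxz : x ⬝ᵥ z = 0) (hyz : y ⬝ᵥ z = 0) :
    x ⬝ᵥ x ≠ 7 := by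
  obtain ⟨i, hi, hi0⟩ := exists_eq_zero_of_dotProduct_self_eq_one hy
  obtain ⟨j, hj, hj0⟩ := exists_eq_zero_of_dotProduct_self_eq_one hz
  have hdy : ∀ w : Fin n → ℤ, w ⬝ᵥ y = w i * y i := fun w =>
    Finset.sum_eq_single i (fun k _ hk => by rw [hi0 k hk, mul_zero]) (by simp)
  have hdz : ∀ w : Fin n → ℤ, w ⬝ᵥ z = w j * z j := fun w =>
    Finset.sum_eq_single j (fun k _ hk => by rw [hj0 k hk, mul_zero]) (by simp)
  rw [hdy] at hxy
  rw [hdz] at hxz hyz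
  have hxi : x i = 0 := by simpa [hi] using hxy
  have hxj : x j = 0 := by simpa [hj] using hxz
  have hij : j ≠ i := by
    rintro rfl
    simp [hi, hj] at hyz
  have hcard : ((Finset.univ.erase i).erase j).card ≤ 3 := by
    rw [Finset.card_erase_of_mem (by simp [hij]), Finset.card_erase_of_mem (Finset.mem_univ _),
      Finset.card_univ, Fintype.card_fin]
    omega
  have h7 := sum_sq_ne_seven_of_card_le_three hcard x
  have hsum : x ⬝ᵥ x = ∑ k ∈ (Finset.univ.erase i).erase j, x k ^ 2 := by
    rw [Finset.sum_erase _ (by rw [hxj]; rfl), Finset.sum_erase _ (by rw [hxi]; rfl)]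
    exact Finset.sum_congr rfl fun k _ => (sq _).symm
  rwa [hsum]

theorem dotProduct_sq_le {n : ℕ} (x y : Fin n → ℤ) : (x ⬝ᵥ y) ^ 2 ≤ (x ⬝ᵥ x) * (y ⬝ᵥ y) := by
  have := Finset.sum_mul_sq_le_sq_mul_sq Finset.univ x y
  simpa [dotProduct, sq] using this

end SumOfThreeSquares

/-- The only positive semidefinite integral Gram matrix satisfying the three linear relations. -/
theorem gram_eq_of_relations {a X Y Z P Q R : ℤ} (ha : 4 ≤ a)
    (h0 : X + (a + 1) * Z + 2 * R = a + 9) (h1 : 2 * P - a * Y + Z = 3 - a)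
    (h2 : 2 * Q + Y + 2 * R + (a + 1) * Z = a + 2)
    (hX : 0 ≤ X) (hY : 0 ≤ Y) (hZ : 0 ≤ Z) (hR : R ^ 2 ≤ Y * Z) (hQ : Q ^ 2 ≤ X * Z)
    (hP : ∀ t : ℤ, (P + t * Q) ^ 2 ≤ X * (Y + 2 * t * R + t ^ 2 * Z)) :
    X = 8 ∧ Y = 1 ∧ Z = 1 ∧ P = 1 ∧ Q = 0 ∧ R = 0 := by
  -- Parity in `h1` and `h2` makes Y and Z odd, so each is 1 or at least 3.
  have hodd : (∃ j, Y = 2 * j + 1) ∧ ∃ j, Z = 2 * j + 1 := by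
    rcases Int.even_or_odd' a with ⟨k, rfl | rfl⟩
    · have hz : ∃ j, Z = 2 * j + 1 := ⟨1 - k - P + k * Y, by linarith⟩
      refine ⟨?_, hz⟩
      obtain ⟨j, rfl⟩ := hz
      exact ⟨k - Q - R - k * (2 * j + 1) - j, by linarith⟩
    · have hy : ∃ j, Y = 2 * j + 1 := ⟨k + 1 - Q - R - (k + 1) * Z, by linarith⟩
      refine ⟨hy, ?_⟩
      obtain ⟨j, rfl⟩ := hy
      exact ⟨1 - P + 2 * k * j + j, by linarith⟩
  obtain ⟨⟨i, hi⟩, j, hj⟩ := hodd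
  have hP0 := hP 0
  simp only [zero_mul, mul_zero, add_zero, ne_eq, OfNat.ofNat_ne_zero, not_false_eq_true,
    zero_pow] at hP0
  obtain hZ1 | hZ3 : Z = 1 ∨ 3 ≤ Z := by omega
  · subst hZ1
    rw [mul_one] at hR
    obtain hY1 | hY3 : Y = 1 ∨ 3 ≤ Y := by omega
    · subst hY1
      have hR1 : -1 ≤ R ∧ R ≤ 1 := abs_le.1 (sq_le_one_iff_abs_le_one R |>.1 hR)
      -- R = ∓1 would mean y ± z = 0, whereas its product with x comes out as 2.
      obtain rfl | rfl | rfl : R = -1 ∨ R = 0 ∨ R = 1 := by omega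
      · have e1 : P = 1 := by linarith
        have e2 : Q = 1 := by linarith
        have := hP 1
        subst e1 e2
        norm_num at this
      · refine ⟨?_, ?_, ?_, ?_, ?_, ?_⟩ <;> linarith
      · have e1 : P = 1 := by linarith
        have e2 : Q = -1 := by linarith
        have := hP (-1)
        subst e1 e2
        norm_num at this
    -- `h1` forces P to be large while `h0` bounds X, against P² ≤ XY. Only Y = 3 survives, and it
    -- falls to Cauchy–Schwarz for x and y + z.
    · have hRY : -2 * R ≤ Y + 1 := by nlinarith [sq_nonneg (R + 1)]
      have hP2 : 4 * Y - 2 ≤ 2 * P := by nlinarith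
      have hsq : (4 * Y - 2) ^ 2 ≤ (2 * P) ^ 2 := by gcongr; omega
      have hXY : X * Y ≤ (9 + Y) * Y := by gcongr; omega
      have hY3' : Y = 3 := by
        by_contra hne
        have hY5 : 5 ≤ Y := by omega
        nlinarith
      subst hY3'
      have hR1 : -1 ≤ R := by nlinarith
      have hP10 : 10 ≤ 2 * P := by omega
      have hR1' : R = -1 := by
        by_contra hne
        have hX8 : X ≤ 8 := by omega
        have hP5 : 5 ≤ P := by omega
        nlinarith
      subst hR1'
      have hX10 : X = 10 := by linarith
      have hQ0 : Q = 0 := by linarith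
      subst hX10 hQ0
      have := hP 1
      nlinarith
  · exfalso
    obtain hY1 | hY3 : Y = 1 ∨ 3 ≤ Y := by omega
    · subst hY1
      rw [one_mul] at hR
      have hRZ : -2 * R ≤ Z + 1 := by nlinarith [sq_nonneg (R + 1)]
      have hZ3' : Z = 3 := by
        by_contra hne
        have hZ5 : 5 ≤ Z := by omega
        nlinarith
      subst hZ3'
      have hR1 : -1 ≤ R := by nlinarith
      have hX0 : X = 0 := by linarith
      have hR1' : R = -1 := by linarith
      subst hX0 hR1'
      rw [zero_mul] at hQ
      have hQ0 : Q = 0 := by nlinarith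
      subst hQ0
      linarith
    · have hRYZ : -2 * R ≤ Y + Z := by
        refine (le_abs_self _).trans (abs_le_of_sq_le_sq ?_ (by omega))
        nlinarith [sq_nonneg (Y - Z)]
      have h3 : a * (Z - 1) ≤ 9 + Y := by nlinarith
      have h4 : 4 * Z ≤ 13 + Y := by nlinarith
      have hXY : X ≤ 1 + Y := by nlinarith
      have h5 : 15 * Y - 17 ≤ 8 * P := by nlinarith
      have h6 : (15 * Y - 17) ^ 2 ≤ (8 * P) ^ 2 := by gcongr; omega
      have h7 : X * Y ≤ (1 + Y) * Y := by gcongr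
      nlinarith

/-! ### The order ℤ[ρ]. -/

namespace EnnolaCubic

open Matrix

variable {K : Type*} [Field K] {a : ℤ} {ρ : K}

theorem relations (hρ : ρ ^ 3 + ((a : K) - 1) * ρ ^ 2 - (a : K) * ρ - 1 = 0) (x y z : K) :
    (x + y * ρ + z * (ρ ^ 2 + a * ρ)) ^ 2 =
      (x ^ 2 + (a + 1) * z ^ 2 + 2 * (y * z)) + (2 * (x * y) - a * y ^ 2 + z ^ 2) * ρ +
      (2 * (x * z) + y ^ 2 + 2 * (y * z) + (a + 1) * z ^ 2) * (ρ ^ 2 + a * ρ) := by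
  have h3 : ρ ^ 3 = 1 + a * ρ - (a - 1) * ρ ^ 2 := by linear_combination hρ
  have h4 : ρ ^ 4 = ρ + a * ρ ^ 2 - (a - 1) * (1 + a * ρ - (a - 1) * ρ ^ 2) := by
    linear_combination (ρ - (a - 1)) * hρ
  ring_nf
  rw [h3, h4]
  ring

theorem exists_coords (hρ : ρ ^ 3 + ((a : K) - 1) * ρ ^ 2 - (a : K) * ρ - 1 = 0) {x : K}
    (hx : x ∈ Algebra.adjoin ℤ ({ρ} : Set K)) :
    ∃ c : Fin 3 → ℤ, x = c 0 + c 1 * ρ + c 2 * (ρ ^ 2 + a * ρ) := by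
  induction hx using Algebra.adjoin_induction with
  | mem x hx =>
    rw [Set.mem_singleton_iff] at hx
    exact ⟨![0, 1, 0], by simp [hx]⟩
  | algebraMap r => exact ⟨![r, 0, 0], by simp⟩
  | add x y _ _ hx hy =>
    obtain ⟨c, rfl⟩ := hx
    obtain ⟨d, rfl⟩ := hy
    exact ⟨c + d, by simp only [Pi.add_apply]; push_cast; ring⟩
  | mul x y _ _ hx hy =>
    obtain ⟨c, rfl⟩ := hx
    obtain ⟨d, rfl⟩ := hy
    -- With ω = ρ² + aρ: ρ² = ω - aρ, ρω = 1 + ω and ω² = (a + 1) + ρ + (a + 1)ω.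
    refine ⟨![c 0 * d 0 + (a + 1) * (c 2 * d 2) + (c 1 * d 2 + c 2 * d 1),
      c 0 * d 1 + c 1 * d 0 - a * (c 1 * d 1) + c 2 * d 2,
      c 0 * d 2 + c 2 * d 0 + c 1 * d 1 + (c 1 * d 2 + c 2 * d 1) + (a + 1) * (c 2 * d 2)], ?_⟩
    simp only [Matrix.cons_val_zero, Matrix.cons_val_one, Matrix.cons_val]
    push_cast
    have h3 : ρ ^ 3 = 1 + a * ρ - (a - 1) * ρ ^ 2 := by linear_combination hρ
    have h4 : ρ ^ 4 = ρ + a * ρ ^ 2 - (a - 1) * (1 + a * ρ - (a - 1) * ρ ^ 2) := by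
      linear_combination (ρ - (a - 1)) * hρ
    ring_nf
    rw [h3, h4]
    ring

open Polynomial in
-- The cubic is irreducible over ℚ: a rational root would be an integer dividing 1, but the values
-- at 1 and -1 are -1 and 2a - 3.
theorem coords_eq_zero [CharZero K] (ha : 4 ≤ a)
    (hρ : ρ ^ 3 + ((a : K) - 1) * ρ ^ 2 - (a : K) * ρ - 1 = 0) {x y z : ℤ}
    (h : (x : K) + y * ρ + z * (ρ ^ 2 + a * ρ) = 0) : x = 0 ∧ y = 0 ∧ z = 0 := by
  let _ : Algebra ℚ K := DivisionRing.toRatAlgebra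
  set p : ℤ[X] := X ^ 3 + C (a - 1) * X ^ 2 + C (-a) * X + C (-1) with hp
  have hpdeg : p.natDegree = 3 := by rw [hp]; compute_degree!
  have hpm : p.Monic := by rw [hp]; monicity!
  have hirr : Irreducible (p.map (algebraMap ℤ ℚ)) := by
    rw [Polynomial.irreducible_iff_roots_eq_zero_of_degree_le_three]
    · rw [Multiset.eq_zero_iff_forall_notMem]
      intro r hr
      have hr0 : aeval r p = 0 := by
        have := (mem_roots'.1 hr).2
        rwa [IsRoot.def, eval_map_algebraMap] at this
      obtain ⟨n, rfl⟩ := isInteger_of_is_root_of_monic hpm hr0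
      have hn : n ^ 3 + (a - 1) * n ^ 2 - a * n - 1 = 0 := by
        have h1 : aeval ((algebraMap ℤ ℚ) n) p = algebraMap ℤ ℚ (p.eval n) := by
          rw [aeval_algebraMap_apply_eq_algebraMap_eval]
        rw [h1] at hr0
        have h2 : p.eval n = 0 := (algebraMap ℤ ℚ).injective_int (by rw [hr0, map_zero])
        simp [hp] at h2
        linarith
      have hunit : IsUnit n := .of_mul_eq_one (n ^ 2 + (a - 1) * n - a) (by linarith)
      rcases Int.isUnit_iff.1 hunit with rfl | rfl <;> linarith
    · rw [hpm.natDegree_map, hpdeg]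
      norm_num
    · rw [hpm.natDegree_map, hpdeg]
  have hroot : aeval ρ (p.map (algebraMap ℤ ℚ)) = 0 := by
    rw [aeval_map_algebraMap]
    simp [hp]
    linear_combination hρ
  have hmin := minpoly.eq_of_irreducible_of_monic hirr hroot (hpm.map _)
  set q : ℚ[X] := C (z : ℚ) * X ^ 2 + C ((y + a * z : ℤ) : ℚ) * X + C (x : ℚ) with hq
  have hq0 : q = 0 := by
    by_contra hne
    have h1 := minpoly.degree_le_of_ne_zero ℚ ρ hne (by
      rw [hq]
      simp
      linear_combination h)
    have h2 : q.degree ≤ 2 := by rw [hq]; compute_degree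
    rw [← hmin, hpm.degree_map, degree_eq_natDegree hpm.ne_zero, hpdeg] at h1
    exact absurd (h1.trans h2) (by norm_cast)
  have c0 : q.coeff 0 = x := by simp [hq]
  have c1 : q.coeff 1 = y + a * z := by
    rw [hq, coeff_add, coeff_add, coeff_C_mul_X_pow, coeff_C_mul_X, coeff_C_succ]
    norm_num
  have c2 : q.coeff 2 = z := by
    rw [hq, coeff_add, coeff_add, coeff_C_mul_X_pow, coeff_C_mul_X, coeff_C_succ]
    norm_num
  rw [hq0, coeff_zero] at c0 c1 c2
  have hz : z = 0 := by exact_mod_cast c2.symm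
  have hx : x = 0 := by exact_mod_cast c0.symm
  refine ⟨hx, ?_, hz⟩
  rw [hz] at c1
  simpa using c1.symm

/-- The sum depends on M only through its Gram matrix, so M may be replaced by a six-row matrix with
the same Gram matrix. -/
theorem sum_sq_coords {ι : Type*} [Fintype ι] (M : Matrix ι (Fin 3) ℤ) (ω : Fin 3 → K) :
    ∑ i, (∑ j, (M i j : K) * ω j) ^ 2 = ∑ j, ∑ k, ((Mᵀ * M) j k : K) * (ω j * ω k) := by
  simp only [sq, Finset.sum_mul_sum]
  rw [Finset.sum_comm]
  refine Finset.sum_congr rfl fun j _ => ?_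
  rw [Finset.sum_comm]
  refine Finset.sum_congr rfl fun k _ => ?_
  rw [Matrix.mul_apply, Int.cast_sum, Finset.sum_mul]
  refine Finset.sum_congr rfl fun i _ => ?_
  rw [Matrix.transpose_apply, Int.cast_mul]
  ring

theorem exists_fin_sum_of_isSumSq {R : Type*} [CommRing R] {x : R} (hx : IsSumSq x) :
    ∃ (n : ℕ) (α : Fin n → R), x = ∑ i, α i ^ 2 := by
  induction hx with
  | zero => exact ⟨0, Fin.elim0, by simp⟩
  | sq_add r _ ih =>
    obtain ⟨n, α, rfl⟩ := ih
    exact ⟨n + 1, Fin.cons r α, by simp [Fin.sum_univ_succ, sq]⟩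

theorem isSumSq_fin_sum {R : Type*} [CommRing R] {n : ℕ} (α : Fin n → R) :
    IsSumSq (∑ i, α i ^ 2) :=
  IsSumSq.sum fun i _ => by rw [sq]; exact IsSumSq.mul_self _

theorem exists_six_squares (hρ : ρ ^ 3 + ((a : K) - 1) * ρ ^ 2 - (a : K) * ρ - 1 = 0) {n : ℕ}
    (α : Fin n → Algebra.adjoin ℤ ({ρ} : Set K)) :
    ∃ β : Fin 6 → Algebra.adjoin ℤ ({ρ} : Set K), ∑ i, α i ^ 2 = ∑ i, β i ^ 2 := by
  choose A hA using fun i => exists_coords hρ (α i).2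
  obtain ⟨B, hB⟩ := IntForm.exists_six_squares (Matrix.of A)
  set r : Algebra.adjoin ℤ ({ρ} : Set K) := ⟨ρ, Algebra.self_mem_adjoin_singleton ℤ ρ⟩
  refine ⟨fun i => B i 0 + B i 1 * r + B i 2 * (r ^ 2 + a * r), Subtype.ext ?_⟩
  have h1 := sum_sq_coords (Matrix.of A) ![1, ρ, ρ ^ 2 + a * ρ]
  have h2 := sum_sq_coords B ![1, ρ, ρ ^ 2 + a * ρ]
  rw [hB, ← h2] at h1
  simp only [Fin.sum_univ_three, Matrix.of_apply, Matrix.cons_val_zero, Matrix.cons_val_one,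
    Matrix.cons_val, mul_one] at h1
  push_cast
  simp only [hA]
  rw [h1]

theorem not_sum_of_five_squares [CharZero K] (ha : 4 ≤ a)
    (hρ : ρ ^ 3 + ((a : K) - 1) * ρ ^ 2 - (a : K) * ρ - 1 = 0) {n : ℕ} (hn : n ≤ 5)
    (α : Fin n → Algebra.adjoin ℤ ({ρ} : Set K)) :
    (7 + (1 + ρ) ^ 2 + (ρ ^ 2 + a * ρ) ^ 2 : K) ≠ ∑ i, (α i : K) ^ 2 := by
  intro heq
  choose A hA using fun i => exists_coords hρ (α i).2
  set x : Fin n → ℤ := fun i => A i 0 with hx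
  set y : Fin n → ℤ := fun i => A i 1 with hy
  set z : Fin n → ℤ := fun i => A i 2 with hz
  have hsum : ∑ i, (α i : K) ^ 2 =
      ((x ⬝ᵥ x + (a + 1) * (z ⬝ᵥ z) + 2 * (y ⬝ᵥ z) : ℤ) : K) +
      ((2 * (x ⬝ᵥ y) - a * (y ⬝ᵥ y) + z ⬝ᵥ z : ℤ) : K) * ρ +
      ((2 * (x ⬝ᵥ z) + y ⬝ᵥ y + 2 * (y ⬝ᵥ z) + (a + 1) * (z ⬝ᵥ z) : ℤ) : K) *
        (ρ ^ 2 + a * ρ) := by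
    simp only [dotProduct]
    push_cast
    simp only [Finset.mul_sum, Finset.sum_mul, ← Finset.sum_add_distrib, ← Finset.sum_sub_distrib]
    refine Finset.sum_congr rfl fun i _ => ?_
    rw [hA, relations hρ]
    ring
  have h1 := relations hρ 1 1 0
  have h2 := relations hρ 0 0 1
  -- The element has coordinates a + 9, 3 - a, a + 2 in the basis 1, ρ, ω.
  obtain ⟨e0, e1, e2⟩ := coords_eq_zero ha hρ
    (x := x ⬝ᵥ x + (a + 1) * (z ⬝ᵥ z) + 2 * (y ⬝ᵥ z) - (a + 9))
    (y := 2 * (x ⬝ᵥ y) - a * (y ⬝ᵥ y) + z ⬝ᵥ z - (3 - a))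
    (z := 2 * (x ⬝ᵥ z) + y ⬝ᵥ y + 2 * (y ⬝ᵥ z) + (a + 1) * (z ⬝ᵥ z) - (a + 2)) (by
      rw [Int.cast_sub, Int.cast_sub, Int.cast_sub]
      rw [hsum] at heq
      push_cast at heq ⊢
      linear_combination -heq + h1 + h2)
  have hnn : ∀ w : Fin n → ℤ, 0 ≤ w ⬝ᵥ w := fun w =>
    Finset.sum_nonneg fun i _ => mul_self_nonneg (w i)
  obtain ⟨gX, gY, gZ, gP, gQ, gR⟩ := gram_eq_of_relations ha (sub_eq_zero.1 e0) (sub_eq_zero.1 e1)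
    (sub_eq_zero.1 e2) (hnn x) (hnn y) (hnn z) (dotProduct_sq_le y z) (dotProduct_sq_le x z)
    (fun t => by
      have := dotProduct_sq_le x (y + t • z)
      simp only [dotProduct_add, add_dotProduct, dotProduct_smul, smul_dotProduct, smul_eq_mul,
        dotProduct_comm z y] at this
      convert this using 2
      ring)
  -- The shift by y makes x orthogonal to y, with norm 8 - 2 + 1 = 7.
  refine dotProduct_self_ne_seven hn (x := x - y) gY gZ ?_ ?_ gR ?_
  · rw [sub_dotProduct, gP, gY]; norm_num
  · rw [sub_dotProduct, gQ, gR]; norm_num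
  · rw [sub_dotProduct, dotProduct_sub, dotProduct_sub, dotProduct_comm y x, gX, gP, gY]
    norm_num

end EnnolaCubic

theorem theorem1p2 {K : Type*} [Field K] [CharZero K] (a : ℤ) (ha : 4 ≤ a) (ρ : K)
    (hρ : ρ ^ 3 + ((a : K) - 1) * ρ ^ 2 - (a : K) * ρ - 1 = 0) :
    pythagorasNumber (Algebra.adjoin ℤ ({ρ} : Set K)) = 6 := by
  apply le_antisymm
  · refine sInf_le (Set.Subset.antisymm ?_ ?_)
    · intro x hx
      obtain ⟨n, α, rfl⟩ := EnnolaCubic.exists_fin_sum_of_isSumSq hx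
      obtain ⟨β, hβ⟩ := EnnolaCubic.exists_six_squares hρ α
      exact ⟨6, le_rfl, β, hβ⟩
    · rintro x ⟨n, -, α, rfl⟩
      exact EnnolaCubic.isSumSq_fin_sum α
  · refine le_sInf fun m hm => ?_
    by_contra! hlt
    set r : Algebra.adjoin ℤ ({ρ} : Set K) := ⟨ρ, Algebra.self_mem_adjoin_singleton ℤ ρ⟩
    have hγ : IsSumSq (7 + (1 + r) ^ 2 + (r ^ 2 + a * r) ^ 2) := by
      have h7 : (7 : Algebra.adjoin ℤ ({ρ} : Set K)) = 1 * 1 + 1 * 1 + 1 * 1 + 2 * 2 := by norm_num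
      rw [h7, sq (1 + r), sq (r ^ 2 + a * r)]
      exact ((((IsSumSq.mul_self _).add (.mul_self _)).add (.mul_self _)).add (.mul_self _)).add
        (.mul_self _) |>.add (.mul_self _)
    obtain ⟨n, hnm, α, hα⟩ := hm.subset hγ
    have hn : n < 6 := by exact_mod_cast hnm.trans_lt hlt
    refine EnnolaCubic.not_sum_of_five_squares ha hρ (by omega) α ?_
    have hα' := congrArg Subtype.val hα
    push_cast at hα'
    exact hα'
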